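/- For nonnegative integers $r,s,n$ with $r+s\le n$ let $$\mathbb B^n_{r,s}=\Big\{[z_0,\dots,z_n]\in\mathbb P^n:\ \sum_{i=0}^{r}|z_i|^2>\sum_{j=r+1}^{r+s}|z_j|^2\Big\},$$ let $\partial\mathbb B^n_{r,s}$ be its topological boundary in the complex projective space $\mathbb P^n$, and let $\mathrm{Aut}(\mathbb B^n_{r,s})$ be the group of biholomorphic maps of $\mathbb B^n_{r,s}$ onto itself. Theorem. Let $r+s\le n$, $r'+s'\le m$ and $1\le r'\le r<s$. Let $U\subset\mathbb P^n$ be a connected open set with $U\cap\partial\mathbb B^n_{r,s}\ne\emptyset$, and let $f:U\to\mathbb P^m$ be a holomorphic map such that $f(U\cap\mathbb B^n_{r,s})\subset\mathbb B^m_{r',s'}$ and $f(U\cap\partial\mathbb B^n_{r,s})\subset\partial\mathbb B^m_{r',s'}$. Then $r=r'$ and $s\le s'$. Moreover there exist an open set $U'\subset\mathbb B^n_{r,s}\cap\{z_0\ne0\}$ containing $[1,0,\dots,0]$, automorphisms $\Xi\in\mathrm{Aut}(\mathbb B^n_{r,s})$ and $\Phi\in\mathrm{Aut}(\mathbb B^m_{r',s'})$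 with $\Xi(U')\subset U$, and holomorphic functions $\psi_1,\dots,\psi_{m-r'-s'}$ on $U'$ such that $$\Phi\circ f\circ\Xi([1,z_1,\dots,z_n])=[1,z_1,\dots,z_{r+s},0,\dots,0,\psi_1,\dots,\psi_{m-r'-s'}]$$ for all $[1,z_1,\dots,z_n]\in U'$, where the number of zeros is $s'-s$. -/

import Mathlib

open Set Filter Topology

/-- The complex projective space of dimension `n`, with homogeneous coordinates
`[z 0, …, z n]`. -/
abbrev CProj (n : ℕ) : Type := Projectivization ℂ (Fin (n + 1) → ℂ)

/-- The quotient topology on complex projective space. -/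
noncomputable instance CProj.instTopologicalSpace (n : ℕ) : TopologicalSpace (CProj n) :=
  TopologicalSpace.coinduced
    (Projectivization.mk' ℂ : {v : Fin (n + 1) → ℂ // v ≠ 0} → CProj n) inferInstance

/-- The generalized ball: the points `[z 0, …, z n]` with
`|z 0|² + ⋯ + |z r|² > |z (r+1)|² + ⋯ + |z (r+s)|²`. -/
def genBall (n r s : ℕ) : Set (CProj n) :=
  {p | ∑ i ∈ Finset.univ.filter (fun i : Fin (n + 1) => r < (i : ℕ) ∧ (i : ℕ) ≤ r + s), ‖p.rep i‖ ^ 2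
      < ∑ i ∈ Finset.univ.filter (fun i : Fin (n + 1) => (i : ℕ) ≤ r), ‖p.rep i‖ ^ 2}

/-- Membership in a generalized ball does not depend on the homogeneous coordinates. -/
theorem mk_mem_genBall_iff {n : ℕ} (r s : ℕ) (v : Fin (n + 1) → ℂ) (hv : v ≠ 0) :
    Projectivization.mk ℂ v hv ∈ genBall n r s ↔
      ∑ i ∈ Finset.univ.filter (fun i : Fin (n + 1) => r < (i : ℕ) ∧ (i : ℕ) ≤ r + s), ‖v i‖ ^ 2
        < ∑ i ∈ Finset.univ.filter (fun i : Fin (n + 1) => (i : ℕ) ≤ r), ‖v i‖ ^ 2 := by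
  obtain ⟨a, ha⟩ := Projectivization.exists_smul_eq_mk_rep ℂ v hv
  have ha0 : 0 < ‖(a : ℂ)‖ ^ 2 := by
    have := norm_pos_iff.mpr a.ne_zero
    positivity
  have key : ∀ i, ‖(Projectivization.mk ℂ v hv).rep i‖ ^ 2 = ‖(a : ℂ)‖ ^ 2 * ‖v i‖ ^ 2 := by
    intro i
    rw [← ha, Units.smul_def, Pi.smul_apply, smul_eq_mul, norm_mul, mul_pow]
  unfold genBall
  simp only [Set.mem_ofPred_eq, key, ← Finset.mul_sum]
  exact mul_lt_mul_iff_right₀ ha0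

/-- Holomorphy on an open set `U` of projective space of a map into a projective space: near
every point, in homogeneous coordinates, `f` has the form `[w] ↦ [F 0 w, …, F m w]` with
holomorphic functions `F j` without common zeros. The values of `f` outside `U` play no role. -/
def HolOn {n m : ℕ} (f : CProj n → CProj m) (U : Set (CProj n)) : Prop :=
  ∀ (v : Fin (n + 1) → ℂ) (hv : v ≠ 0), Projectivization.mk ℂ v hv ∈ U →
    ∃ F : (Fin (n + 1) → ℂ) → (Fin (m + 1) → ℂ), AnalyticAt ℂ F v ∧
      ∀ᶠ w in 𝓝 v, ∃ (hw : w ≠ 0) (hF : F w ≠ 0),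
        f (Projectivization.mk ℂ w hw) = Projectivization.mk ℂ (F w) hF

/-- `g` restricts to a biholomorphic map of the open set `D` onto itself. -/
def IsHolAut {n : ℕ} (D : Set (CProj n)) (g : CProj n → CProj n) : Prop :=
  MapsTo g D D ∧ HolOn g D ∧
    ∃ h : CProj n → CProj n, MapsTo h D D ∧ HolOn h D ∧ InvOn h g D D

/-- The affine coordinates `(z 1, …, z n) ↦ [1, z 1, …, z n]`; here `z j` has index `j - 1`. -/
noncomputable def affPt {n : ℕ} (z : Fin n → ℂ) : CProj n :=
  Projectivization.mk ℂ (Fin.cons 1 z : Fin (n + 1) → ℂ)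
    (fun h => one_ne_zero (α := ℂ) (by simpa using congrFun h 0))

/-- The vector `(1, z 1, …, z k, 0, …, 0, w 1, …, w (m - a - b))` of length `m + 1`,
for `k ≤ n` and `k ≤ a + b ≤ m`. -/
noncomputable def normalVec {n : ℕ} (k m a b : ℕ) (z : Fin n → ℂ) (w : Fin (m - a - b) → ℂ) :
    Fin (m + 1) → ℂ :=
  fun i =>
    if h₁ : (i : ℕ) ≤ k ∧ (i : ℕ) ≤ n then
      (Fin.cons 1 z : Fin (n + 1) → ℂ) ⟨i, Nat.lt_succ_of_le h₁.2⟩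
    else if h₂ : (i : ℕ) ≤ a + b then 0
    else w ⟨(i : ℕ) - (a + b + 1), by omega⟩

theorem normalVec_ne_zero {n : ℕ} (k m a b : ℕ) (z : Fin n → ℂ) (w : Fin (m - a - b) → ℂ) :
    normalVec k m a b z w ≠ 0 := by
  intro h
  have h0 := congrFun h 0
  simp [normalVec] at h0

/-!
The proof passes to homogeneous coordinates. The generalized ball is `{H > 0}` for the Hermitian
form `H = signForm n r s`, and its boundary is the set of null vectors. Near a null vector `v` the
map `f` has a holomorphic lift `F`, and after dropping the coordinates in the radical of the target
form, `F` sends null vectors to null vectors of a form `H'` of signature `(r' + 1, s')` and positive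
vectors to positive vectors.

*Orthogonality.* Polarizing the null condition along a complex curve gives
`H x w = 0 → H' (F x) (F w) = 0` near `v` (`exists_ball_orthogonal`). A linear isometry up to scale
contracts a fixed orthonormal frame into the neighbourhood of `v` (`exists_isometry_contracting`),
so after composing with it `F` is an orthogonal map on a convex open set `O` containing the positive
frame vectors `e l` and the null vectors `(e l + d l) / 2`, where the `d l` are negative and `r < s`
provides enough of them. The images of the `e l` are orthogonal and positive, which forces `r = r'`.

*Linearity.* An isotropic frame of `r + 1` vectors together with a vector in the span of two of its
members is mapped to an isotropic family of `r + 2` vectors, which is dependent because `H'` has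
only `r + 1` positive squares. The isotropic frames form a set of uniqueness for holomorphic
functions of frames, so the dependence holds for all frames (`IsLocalOrthogonal.dependent`). As the
image of `F` does not lie in a space of dimension `r + 1` (`IsLocalOrthogonal.exists_notMem_span`),
the additional vectors can be removed: `F` maps planes into planes
(`IsLocalOrthogonal.dependent_of_plane`). A local fundamental theorem of projective geometry
(`exists_diagonal_of_collinear`) makes `F` projectively linear on suitable three-dimensional spaces,
and comparison with orthogonality shows that `H' (F x) (F w)` equals `H x w` times a function of `x`
times a function of `w` (`IsLocalOrthogonal.rank_one`). Hence `F = g • A` with a linear isometry `A`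
(`IsLocalOrthogonal.exists_isometry`).

*Normalization.* The images of the basis vectors under `A` are completed to an orthonormal basis,
whence `s ≤ s'` and an isometry of the target that turns `A` into the standard inclusion
(`exists_isometry_normalizing`). The dropped coordinates, divided by `g`, are the functions `ψ j`.
-/

/-! ### Sets of uniqueness and linear dependence -/

/-- An analytic function on a connected open set that vanishes on the part of a vertical line
inside the set vanishes identically, provided the line meets the set. -/
theorem eq_zero_of_eq_zero_on_vertical_line {V : Set ℂ} (hV : IsOpen V) (hVc : IsPreconnected V)
    {h : ℂ → ℂ} (hh : AnalyticOnNhd ℂ h V) {t₀ : ℂ} (ht₀ : t₀ ∈ V)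
    (h0 : ∀ t ∈ V, t.re = t₀.re → h t = 0) : ∀ t ∈ V, h t = 0 := by
  have hfreq : ∃ᶠ t in 𝓝[≠] t₀, h t = 0 := by
    have hc : Tendsto (fun y : ℝ => t₀ + (y : ℂ) * Complex.I) (𝓝[≠] 0) (𝓝[≠] t₀) := by
      refine tendsto_nhdsWithin_iff.mpr ⟨?_, ?_⟩
      · have : Continuous (fun y : ℝ => t₀ + (y : ℂ) * Complex.I) := by fun_prop
        have := (this.tendsto 0).mono_left (nhdsWithin_le_nhds (s := {0}ᶜ))
        simpa using this
      · filter_upwards [self_mem_nhdsWithin] with y hy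
        simpa using hy
    have hev : ∀ᶠ y : ℝ in 𝓝[≠] 0, h (t₀ + (y : ℂ) * Complex.I) = 0 := by
      have : ∀ᶠ t in 𝓝[≠] t₀, t ∈ V := nhdsWithin_le_nhds (hV.mem_nhds ht₀)
      filter_upwards [hc.eventually this] with y hy
      exact h0 _ hy (by simp)
    exact hc.frequently hev.frequently
  exact fun t ht => hh.eqOn_zero_of_preconnected_of_frequently_eq_zero hVc ht₀ hfreq ht

/-- Linear dependence of finitely many analytic vectors propagates from any set `S` of uniqueness
for analytic functions: independence at one point is detected by a determinant. -/
theorem not_linearIndependent_of_uniqueness {Q T : Type*} [NormedAddCommGroup Q]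
    [NormedSpace ℂ Q] [NormedAddCommGroup T] [NormedSpace ℂ T] [FiniteDimensional ℂ T]
    {V S : Set Q} {k : ℕ} {G : Fin k → Q → T}
    (hG : ∀ i, AnalyticOnNhd ℂ (G i) V)
    (huniq : ∀ h : Q → ℂ, AnalyticOnNhd ℂ h V → (∀ x ∈ S, h x = 0) → ∀ x ∈ V, h x = 0)
    (hS : ∀ x ∈ S, ¬ LinearIndependent ℂ (fun i => G i x)) :
    ∀ x ∈ V, ¬ LinearIndependent ℂ (fun i => G i x) := by
  intro x₁ hx₁ hli
  obtain ⟨Θ, hΘ⟩ := (Fintype.linearCombination ℂ (fun i => G i x₁)).exists_leftInverse_of_injective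
    (LinearMap.ker_eq_bot.mpr (linearIndependent_iff_injective_fintypeLinearCombination.mp hli))
  have hΘc : ∀ i j, Θ (G i x₁) j = if j = i then 1 else 0 := by
    intro i j
    have := LinearMap.congr_fun hΘ (Pi.single i 1)
    simp only [LinearMap.comp_apply, Fintype.linearCombination_apply_single, one_smul,
      LinearMap.id_apply] at this
    rw [this, Pi.single_apply]
  let D : Q → ℂ := fun x => Matrix.det (Matrix.of fun i j => Θ (G i x) j)
  have hD : AnalyticOnNhd ℂ D V := by
    intro x hx
    have h1 : ∀ i j, AnalyticAt ℂ (fun x => Θ (G i x) j) x := by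
      intro i j
      have h2 := ((LinearMap.proj j ∘ₗ Θ).toContinuousLinearMap.analyticAt (G i x)).comp (hG i x hx)
      exact h2
    simp only [D, Matrix.det_apply]
    refine Finset.analyticAt_fun_sum _ fun σ _ => ?_
    have h3 : AnalyticAt ℂ (fun x => ∏ i, Θ (G (σ i) x) i) x :=
      Finset.analyticAt_fun_prod _ fun i _ => h1 _ _
    exact (analyticAt_const (v := ((Equiv.Perm.sign σ : ℤ) : ℂ))).mul h3 |>.congr (by
      filter_upwards with y
      simp [Units.smul_def])
  have h0 : ∀ x ∈ S, D x = 0 := by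
    intro x hx
    by_contra hne
    refine hS x hx ?_
    have hrows := Matrix.linearIndependent_rows_of_det_ne_zero
      (A := Matrix.of fun i j => Θ (G i x) j) hne
    exact LinearIndependent.of_comp Θ hrows
  have h1 := huniq D hD h0 x₁ hx₁
  have h2 : (Matrix.of fun i j => Θ (G i x₁) j) = (1 : Matrix (Fin k) (Fin k) ℂ) := by
    ext i j
    simp [hΘc, Matrix.one_apply, eq_comm]
  simp [D, h2] at h1

/-- Uniqueness from an open subset of a convex open set. -/
theorem eq_zero_of_eventually_eq_zero {Q : Type*} [NormedAddCommGroup Q] [NormedSpace ℂ Q]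
    {V : Set Q} (hVc : Convex ℝ V) {x₀ : Q} (hx₀ : x₀ ∈ V) {h : Q → ℂ}
    (hh : AnalyticOnNhd ℂ h V) (h0 : ∀ᶠ x in 𝓝 x₀, h x = 0) : ∀ x ∈ V, h x = 0 :=
  fun _ hx => hh.eqOn_zero_of_preconnected_of_eventuallyEq_zero hVc.isPreconnected hx₀ h0 hx

theorem not_linearIndependent_of_eventually {Q T : Type*} [NormedAddCommGroup Q]
    [NormedSpace ℂ Q] [NormedAddCommGroup T] [NormedSpace ℂ T] [FiniteDimensional ℂ T]
    {V : Set Q} (hVc : Convex ℝ V) {x₀ : Q} (hx₀ : x₀ ∈ V) {k : ℕ} {G : Fin k → Q → T}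
    (hG : ∀ i, AnalyticOnNhd ℂ (G i) V)
    (h0 : ∀ᶠ x in 𝓝 x₀, ¬ LinearIndependent ℂ (fun i => G i x)) :
    ∀ x ∈ V, ¬ LinearIndependent ℂ (fun i => G i x) :=
  not_linearIndependent_of_uniqueness hG
    (S := {x | ¬ LinearIndependent ℂ (fun i => G i x)})
    (fun _ hh hS => eq_zero_of_eventually_eq_zero hVc hx₀ hh (h0.mono fun x hx => hS x hx))
    (fun _ hx => hx)

/-! ### The fundamental theorem of projective geometry for germs -/

/-- The one-variable core of the local fundamental theorem of projective geometry: if the map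
`(s, t) ↦ (φ s, ψ t)` sends collinear points to collinear points, `φ 0 = 0` and `ψ` is not
constant, then `φ` is linear near `0`. -/
theorem linear_of_collinear_separated {ρ : ℝ} (hρ : 0 < ρ) {φ ψ : ℂ → ℂ}
    {t₀ : ℂ} (ht₀ : ‖t₀‖ < ρ) (hψ : DifferentiableAt ℂ ψ t₀) (hψ' : deriv ψ t₀ ≠ 0)
    (hcol : ∀ Δ δ c : ℂ, ‖Δ‖ < ρ → ‖t₀ + δ‖ < ρ → ‖c‖ < 1 → ‖t₀ + c * δ‖ < ρ →
      φ (c * Δ) * (ψ (t₀ + δ) - ψ t₀) = φ Δ * (ψ (t₀ + c * δ) - ψ t₀)) :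
    ∃ γ : ℂ, ∀ s : ℂ, ‖s‖ < ρ / 2 → φ s = γ * s := by
  have hscale : ∀ Δ c : ℂ, ‖Δ‖ < ρ → ‖c‖ < 1 → φ (c * Δ) = c * φ Δ := by
    intro Δ c hΔ hc
    have h1 : HasDerivAt (fun δ : ℂ => φ (c * Δ) * (ψ (t₀ + δ) - ψ t₀))
        (φ (c * Δ) * deriv ψ t₀) 0 := by
      have h := hψ.hasDerivAt
      have h' : HasDerivAt (fun δ : ℂ => ψ (t₀ + δ)) (deriv ψ t₀) 0 := by
        have := HasDerivAt.comp_const_add (f := ψ) (f' := deriv ψ t₀) t₀ 0 (by simpa using h)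
        exact this
      exact (h'.sub_const _).const_mul _
    have h2 : HasDerivAt (fun δ : ℂ => φ Δ * (ψ (t₀ + c * δ) - ψ t₀))
        (φ Δ * (deriv ψ t₀ * c)) 0 := by
      have h := hψ.hasDerivAt
      have hin : HasDerivAt (fun δ : ℂ => t₀ + c * δ) c 0 := by
        simpa using ((hasDerivAt_id (0 : ℂ)).const_mul c).const_add t₀
      have h' : HasDerivAt (fun δ : ℂ => ψ (t₀ + c * δ)) (deriv ψ t₀ * c) 0 :=
        HasDerivAt.comp (h₂ := ψ) (0 : ℂ) (by simpa using h) hin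
      exact (h'.sub_const _).const_mul _
    have hev : ∀ᶠ δ : ℂ in 𝓝 0, ‖t₀ + δ‖ < ρ ∧ ‖t₀ + c * δ‖ < ρ := by
      have c1 : Continuous fun δ : ℂ => ‖t₀ + δ‖ := by fun_prop
      have c2 : Continuous fun δ : ℂ => ‖t₀ + c * δ‖ := by fun_prop
      exact (c1.tendsto 0 |>.eventually_lt_const (by simpa using ht₀)).and
        (c2.tendsto 0 |>.eventually_lt_const (by simpa using ht₀))
    have h3 : HasDerivAt (fun δ : ℂ => φ (c * Δ) * (ψ (t₀ + δ) - ψ t₀))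
        (φ Δ * (deriv ψ t₀ * c)) 0 := by
      refine h2.congr_of_eventuallyEq ?_
      filter_upwards [hev] with δ hδ
      exact hcol Δ δ c hΔ hδ.1 hc hδ.2
    have h4 := h1.unique h3
    refine mul_right_cancel₀ hψ' ?_
    rw [h4]; ring
  refine ⟨φ (ρ / 2 : ℝ) / (ρ / 2 : ℝ), fun s hs => ?_⟩
  have hne : ((ρ / 2 : ℝ) : ℂ) ≠ 0 := by
    exact_mod_cast (by positivity : (ρ / 2 : ℝ) ≠ 0)
  have hn : ‖((ρ / 2 : ℝ) : ℂ)‖ = ρ / 2 := by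
    rw [Complex.norm_real, Real.norm_of_nonneg (by positivity)]
  have h1 := hscale (ρ / 2 : ℝ) (s / (ρ / 2 : ℝ)) (by rw [hn]; linarith)
    (by rw [norm_div, hn, div_lt_one (by positivity)]; exact hs)
  rw [div_mul_cancel₀ _ hne] at h1
  rw [h1]; ring

theorem fin_three_cases {i j k : Fin 3} (hij : i ≠ j) (hik : i ≠ k) (hjk : j ≠ k) (l : Fin 3) :
    l = i ∨ l = j ∨ l = k := by
  revert i j k l; decide

theorem det_eq_zero_of_not_linearIndependent {x y z : Fin 3 → ℂ}
    (h : ¬ LinearIndependent ℂ ![x, y, z]) (i j k : Fin 3) :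
    x i * (y j * z k - y k * z j) - x j * (y i * z k - y k * z i)
      + x k * (y i * z j - y j * z i) = 0 := by
  rw [Fintype.not_linearIndependent_iff] at h
  obtain ⟨g, hg, l, hl⟩ := h
  have hc : ∀ a, g 0 * x a + g 1 * y a + g 2 * z a = 0 := by
    intro a
    have := congrFun hg a
    simpa [Fin.sum_univ_three] using this
  have hi := hc i
  have hj := hc j
  have hk := hc k
  refine mul_left_cancel₀ hl ?_
  rw [mul_zero]
  fin_cases l
  · simp only [Fin.zero_eta]
    linear_combination (y j * z k - y k * z j) * hi - (y i * z k - y k * z i) * hj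
      + (y i * z j - y j * z i) * hk
  · simp only [Fin.mk_one]
    linear_combination (-(x j * z k - x k * z j)) * hi + (x i * z k - x k * z i) * hj
      - (x i * z j - x j * z i) * hk
  · simp only [Fin.reduceFinMk]
    linear_combination (x j * y k - x k * y j) * hi - (x i * y k - x k * y i) * hj
      + (x i * y j - x j * y i) * hk

/-- A local holomorphic version of the fundamental theorem of projective geometry for the plane.
A holomorphic map of an open convex subset of `ℂ³` that fixes the standard basis and sends
vectors of a two-dimensional subspace to linearly dependent vectors is diagonal up to a scalar
function. Here `i`, `j`, `k` are the three coordinates in some order. -/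
theorem exists_diagonal_of_collinear {O : Set (Fin 3 → ℂ)} (hO : IsOpen O) (hOc : Convex ℝ O)
    {G : (Fin 3 → ℂ) → (Fin 3 → ℂ)} (hG : AnalyticOnNhd ℂ G O)
    (hbO : ∀ l, Pi.single l 1 ∈ O) (hb : ∀ l, G (Pi.single l 1) = Pi.single l 1)
    (hl : ∀ a ∈ O, ∀ b ∈ O, ∀ c ∈ O, c ∈ Submodule.span ℂ {a, b} →
      ¬ LinearIndependent ℂ ![G a, G b, G c])
    {i j k : Fin 3} (hij : i ≠ j) (hik : i ≠ k) (hjk : j ≠ k) :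
    ∃ γ : ℂ, ∀ ξ ∈ O, ξ i * G ξ j = γ * ξ j * G ξ i := by
  have hGa : ∀ l, AnalyticOnNhd ℂ (fun ξ => G ξ l) O := fun l ξ hξ =>
    ((ContinuousLinearMap.proj (R := ℂ) (φ := fun _ : Fin 3 => ℂ) l).analyticAt (G ξ)).comp
      (hG ξ hξ)
  have hcases := fin_three_cases hij hik hjk
  have hdet : ∀ a ∈ O, ∀ b ∈ O, ∀ c ∈ O, c ∈ Submodule.span ℂ {a, b} → _ :=
    fun a ha b hb c hc h => det_eq_zero_of_not_linearIndependent (hl a ha b hb c hc h) i j k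
  -- Lines through a vertex of the coordinate triangle are preserved.
  have pencil : ∀ j k : Fin 3, i ≠ j → i ≠ k → j ≠ k → ∀ a ∈ O, ∀ b ∈ O, a i ≠ 0 →
      a i * b j = a j * b i → G a i * G b j = G a j * G b i := by
    intro j k hij hik hjk a ha b hb' hai hab
    have hcases := fin_three_cases hij hik hjk
    have hspan : b ∈ Submodule.span ℂ {a, Pi.single k 1} := by
      rw [Submodule.mem_span_pair]
      refine ⟨b i / a i, b k - b i / a i * a k, ?_⟩
      ext l
      rcases hcases l with rfl | rfl | rfl
      · simp [hik, hai]
      · have : b l = b i / a i * a l := by field_simp; linear_combination hab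
        simp [hjk, this]
      · simp
    have h := det_eq_zero_of_not_linearIndependent (hl a ha _ (hbO k) b hb' hspan) i j k
    rw [hb k] at h
    simp only [Pi.single_eq_same, Pi.single_eq_of_ne hik, Pi.single_eq_of_ne hjk] at h
    linear_combination -h
  let η : ℂ → ℂ → (Fin 3 → ℂ) := fun s t => Pi.single i 1 + s • Pi.single j 1 + t • Pi.single k 1
  have ηi : ∀ s t, η s t i = 1 := fun s t => by simp [η, hij, hik]
  have ηj : ∀ s t, η s t j = s := fun s t => by simp [η, hij.symm, hjk]
  have ηk : ∀ s t, η s t k = t := fun s t => by simp [η, hik.symm, hjk.symm]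
  have η0 : η 0 0 = Pi.single i 1 := by simp [η]
  have hη : Continuous fun p : ℂ × ℂ => η p.1 p.2 := by fun_prop
  have hGi1 : G (Pi.single i 1) i ≠ 0 := by simp [hb]
  obtain ⟨ρ, hρ, hball⟩ : ∃ ρ > 0, ∀ s t : ℂ, ‖s‖ < ρ → ‖t‖ < ρ → η s t ∈ O ∧ G (η s t) i ≠ 0 := by
    have h1 : ∀ᶠ ξ in 𝓝 (η 0 0), ξ ∈ O ∧ G ξ i ≠ 0 := by
      rw [η0]
      exact (hO.eventually_mem (hbO i)).and ((hGa i _ (hbO i)).continuousAt.eventually_ne hGi1)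
    have h2 := (hη.tendsto (0, 0)).eventually h1
    obtain ⟨ρ, hρ, h⟩ := Metric.eventually_nhds_iff.mp h2
    refine ⟨ρ, hρ, fun s t hs ht => h (y := (s, t)) ?_⟩
    simp [Prod.dist_eq, hs, ht]
  have hρ0 : ‖(0 : ℂ)‖ < ρ := by simpa using hρ
  let φ : ℂ → ℂ := fun s => G (η s 0) j / G (η s 0) i
  let ψ : ℂ → ℂ := fun t => G (η 0 t) k / G (η 0 t) i
  have hGφ : ∀ s t, ‖s‖ < ρ → ‖t‖ < ρ → G (η s t) j = G (η s t) i * φ s := by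
    intro s t hs ht
    have h := pencil j k hij hik hjk _ (hball s 0 hs hρ0).1 _ (hball s t hs ht).1
      (by simp [ηi]) (by simp [ηi, ηj])
    have := (hball s 0 hs hρ0).2
    simp only [φ]
    field_simp
    linear_combination h
  have hGψ : ∀ s t, ‖s‖ < ρ → ‖t‖ < ρ → G (η s t) k = G (η s t) i * ψ t := by
    intro s t hs ht
    have h := pencil k j hik hij hjk.symm _ (hball 0 t hρ0 ht).1 _ (hball s t hs ht).1
      (by simp [ηi]) (by simp [ηi, ηk])
    have := (hball 0 t hρ0 ht).2
    simp only [ψ]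
    field_simp
    linear_combination h
  have hφ0 : φ 0 = 0 := by simp [φ, η0, hb, hij.symm]
  have hψd : DifferentiableOn ℂ ψ (Metric.ball 0 ρ) := by
    intro t ht
    have ht' : ‖t‖ < ρ := by simpa using ht
    have hd : ∀ l, DifferentiableAt ℂ (fun t => G (η 0 t) l) t := by
      intro l
      have h1 := (hGa l _ (hball 0 t hρ0 ht').1).differentiableAt
      exact DifferentiableAt.comp (g := fun ξ => G ξ l) t h1 (by simp only [η]; fun_prop)
    exact ((hd k).div (hd i) (hball 0 t hρ0 ht').2).differentiableWithinAt
  obtain ⟨t₀, ht₀, hψ'⟩ : ∃ t₀, ‖t₀‖ < ρ ∧ deriv ψ t₀ ≠ 0 := by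
    by_contra! hcon
    have hψ0 : ∀ t, ‖t‖ < ρ → ψ t = 0 := by
      intro t ht
      have h1 := (convex_ball (0 : ℂ) ρ).is_const_of_fderivWithin_eq_zero (𝕜 := ℂ) hψd
        (fun x hx => by
          rw [fderivWithin_of_isOpen Metric.isOpen_ball hx]
          ext
          simpa using hcon x (by simpa using hx))
        (by simpa using ht : t ∈ Metric.ball (0 : ℂ) ρ)
        (by simpa using hρ : (0 : ℂ) ∈ Metric.ball (0 : ℂ) ρ)
      rw [h1]
      simp [ψ, η0, hb, hik.symm]
    have hev : ∀ᶠ ξ in 𝓝 (Pi.single i 1 : Fin 3 → ℂ), G ξ k = 0 := by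
      have c1 : ContinuousAt (fun ξ : Fin 3 → ℂ => ‖ξ k / ξ i‖) (Pi.single i 1) := by
        have : (Pi.single i 1 : Fin 3 → ℂ) i ≠ 0 := by simp
        fun_prop (disch := assumption)
      have c2 : ContinuousAt (fun ξ : Fin 3 → ℂ => ξ i) (Pi.single i 1) :=
        (continuous_apply i).continuousAt
      filter_upwards [c1.eventually_lt_const (by simpa [hik.symm] using hρ : _ < ρ),
        c2.eventually_ne (by simp : (Pi.single i 1 : Fin 3 → ℂ) i ≠ 0), hO.mem_nhds (hbO i)]
      with ξ h1 h2 h3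
      have hm := hball 0 (ξ k / ξ i) hρ0 h1
      have h := pencil k j hik hij hjk.symm _ hm.1 ξ h3 (by simp [ηi])
        (by rw [ηi, ηk]; field_simp)
      rw [hGψ 0 _ hρ0 h1, hψ0 _ h1] at h
      simpa [hm.2] using h
    have := eq_zero_of_eventually_eq_zero hOc (hbO i) (hGa k) hev _ (hbO k)
    simp [hb] at this
  obtain ⟨γ, hγ⟩ := linear_of_collinear_separated (φ := φ) (ψ := ψ) hρ ht₀
    (hψd.differentiableAt (Metric.isOpen_ball.mem_nhds (by simpa using ht₀))) hψ' (by
      intro Δ δ c hΔ hδ hc hcδ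
      have hcΔ : ‖c * Δ‖ < ρ := by
        rw [norm_mul]
        nlinarith [norm_nonneg c, norm_nonneg Δ]
      have ha := hball 0 t₀ hρ0 ht₀
      have hb' := hball Δ (t₀ + δ) hΔ hδ
      have hc' := hball (c * Δ) (t₀ + c * δ) hcΔ hcδ
      have hspan : η (c * Δ) (t₀ + c * δ) ∈
          Submodule.span ℂ {η 0 t₀, η Δ (t₀ + δ)} := by
        rw [Submodule.mem_span_pair]
        refine ⟨1 - c, c, ?_⟩
        ext l
        rcases hcases l with rfl | rfl | rfl
        · simp [ηi]
        · simp [ηj]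
        · simp only [Pi.add_apply, Pi.smul_apply, ηk, smul_eq_mul]; ring
      have h := hdet _ ha.1 _ hb'.1 _ hc'.1 hspan
      rw [hGφ _ _ hρ0 ht₀, hGψ _ _ hρ0 ht₀, hGφ _ _ hΔ hδ, hGψ _ _ hΔ hδ, hGφ _ _ hcΔ hcδ,
        hGψ _ _ hcΔ hcδ, hφ0] at h
      refine mul_left_cancel₀ (mul_ne_zero (mul_ne_zero ha.2 hb'.2) hc'.2) ?_
      linear_combination -h)
  refine ⟨γ, fun ξ hξ => ?_⟩
  have hev : ∀ᶠ ξ in 𝓝 (Pi.single i 1 : Fin 3 → ℂ), ξ i * G ξ j - γ * ξ j * G ξ i = 0 := by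
    have c1 : ContinuousAt (fun ξ : Fin 3 → ℂ => ‖ξ j / ξ i‖) (Pi.single i 1) := by
      have : (Pi.single i 1 : Fin 3 → ℂ) i ≠ 0 := by simp
      fun_prop (disch := assumption)
    have c2 : ContinuousAt (fun ξ : Fin 3 → ℂ => ξ i) (Pi.single i 1) :=
        (continuous_apply i).continuousAt
    filter_upwards [c1.eventually_lt_const (by simpa [hij.symm] using hρ : _ < ρ / 2),
      c2.eventually_ne (by simp : (Pi.single i 1 : Fin 3 → ℂ) i ≠ 0), hO.mem_nhds (hbO i)]
      with ξ h1 h2 h3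
    have h1' : ‖ξ j / ξ i‖ < ρ := by linarith
    have hm := hball (ξ j / ξ i) 0 h1' hρ0
    have h := pencil j k hij hik hjk _ hm.1 ξ h3 (by simp [ηi]) (by rw [ηi, ηj]; field_simp)
    rw [hGφ _ _ h1' hρ0, hγ _ h1] at h
    have h4 := mul_left_cancel₀ hm.2 (h.trans (by ring : _ = G (η (ξ j / ξ i) 0) i *
      (γ * (ξ j / ξ i) * G ξ i)))
    rw [h4]
    field_simp
    ring
  have han : AnalyticOnNhd ℂ (fun ξ => ξ i * G ξ j - γ * ξ j * G ξ i) O := by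
    intro ξ hξ
    have hp : ∀ l, AnalyticAt ℂ (fun ξ : Fin 3 → ℂ => ξ l) ξ := fun l =>
      (ContinuousLinearMap.proj (R := ℂ) (φ := fun _ : Fin 3 => ℂ) l).analyticAt ξ
    exact ((hp i).mul (hGa j ξ hξ)).sub ((analyticAt_const.mul (hp j)).mul (hGa i ξ hξ))
  exact sub_eq_zero.mp (eq_zero_of_eventually_eq_zero hOc (hbO i) han hev ξ hξ)

/-! ### Hermitian forms -/

section HermitianForms

variable {E T : Type*} [NormedAddCommGroup E] [NormedSpace ℂ E]
  [NormedAddCommGroup T] [NormedSpace ℂ T]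

/-- A sesquilinear form is Hermitian. -/
def IsHermitianForm (H : E →ₗ[ℂ] E →ₗ⋆[ℂ] ℂ) : Prop :=
  ∀ x y, (starRingEnd ℂ) (H x y) = H y x

/-- No `k + 1` mutually orthogonal vectors of nonnegative square are linearly independent. For a
Hermitian form this says that subspaces on which it is nonnegative have dimension at most `k`;
nondegenerate forms with `k` positive squares have this property. -/
def NonnegIndexLE (H : T →ₗ[ℂ] T →ₗ⋆[ℂ] ℂ) (k : ℕ) : Prop :=
  ∀ y : Fin (k + 1) → T, (∀ i j, i ≠ j → H (y i) (y j) = 0) → (∀ i, 0 ≤ (H (y i) (y i)).re) →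
    ¬ LinearIndependent ℂ y

theorem IsHermitianForm.eq_zero_symm {H : E →ₗ[ℂ] E →ₗ⋆[ℂ] ℂ} (hH : IsHermitianForm H) {x y : E}
    (h : H x y = 0) : H y x = 0 := by
  rw [← hH, h, map_zero]

theorem IsHermitianForm.self_eq_re {H : E →ₗ[ℂ] E →ₗ⋆[ℂ] ℂ} (hH : IsHermitianForm H) (x : E) :
    H x x = ((H x x).re : ℂ) :=
  (Complex.conj_eq_iff_re.mp (hH x x)).symm

theorem form_sum_left {ι : Type*} [Fintype ι] (H : E →ₗ[ℂ] E →ₗ⋆[ℂ] ℂ) (c : ι → ℂ) (y : ι → E)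
    (v : E) : H (∑ i, c i • y i) v = ∑ i, c i * H (y i) v := by
  simp [map_sum, LinearMap.sum_apply]

theorem form_sum_orthogonal {ι : Type*} [Fintype ι] (H : E →ₗ[ℂ] E →ₗ⋆[ℂ] ℂ) {y : ι → E}
    (hy : ∀ i j, i ≠ j → H (y i) (y j) = 0) (c : ι → ℂ) (j : ι) :
    H (∑ i, c i • y i) (y j) = c j * H (y j) (y j) := by
  rw [form_sum_left, Finset.sum_eq_single j]
  · intro i _ hij
    rw [hy i j hij, mul_zero]
  · simp

theorem linearIndependent_of_orthogonal {ι : Type*} [Fintype ι] {H : E →ₗ[ℂ] E →ₗ⋆[ℂ] ℂ}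
    {y : ι → E} (hy : ∀ i j, i ≠ j → H (y i) (y j) = 0) (hne : ∀ i, H (y i) (y i) ≠ 0) :
    LinearIndependent ℂ y := by
  rw [Fintype.linearIndependent_iff]
  intro c hc i
  have h := form_sum_orthogonal H hy c i
  rw [hc] at h
  simpa [hne i] using h.symm

/-- In a form whose nonnegative index is at most `k`, a vector of nonnegative square orthogonal to
`k` mutually orthogonal positive vectors vanishes. -/
theorem NonnegIndexLE.eq_zero {H : T →ₗ[ℂ] T →ₗ⋆[ℂ] ℂ} (hH : IsHermitianForm H) {k : ℕ}
    (hk : NonnegIndexLE H k) {y : Fin k → T} (hy : ∀ i j, i ≠ j → H (y i) (y j) = 0)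
    (hpos : ∀ i, 0 < (H (y i) (y i)).re) {v : T} (hv : ∀ i, H v (y i) = 0)
    (hv0 : 0 ≤ (H v v).re) : v = 0 := by
  have hli : LinearIndependent ℂ y := linearIndependent_of_orthogonal hy fun i h => by
    have := hpos i
    simp [h] at this
  have hnot := hk (Fin.cons v y) (fun i j => by
      refine Fin.cases ?_ (fun i => ?_) i <;> refine Fin.cases ?_ (fun j => ?_) j
      · simp
      · simpa using fun _ => hv j
      · simpa using hH.eq_zero_symm (hv i)
      · simpa using fun h => hy i j h) (fun i => by
      refine Fin.cases ?_ (fun i => ?_) i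
      · simpa using hv0
      · simpa using (hpos i).le)
  rw [linearIndependent_finCons] at hnot
  have hmem : v ∈ Submodule.span ℂ (Set.range y) := by tauto
  obtain ⟨c, rfl⟩ := (Submodule.mem_span_range_iff_exists_fun ℂ).mp hmem
  refine Finset.sum_eq_zero fun j _ => ?_
  have h := form_sum_orthogonal H hy c j
  rw [hv j] at h
  have hne : H (y j) (y j) ≠ 0 := fun h => by
    have := hpos j
    simp [h] at this
  have : c j = 0 := by simpa [hne] using h.symm
  rw [this, zero_smul]

theorem analyticOnNhd_form_left [FiniteDimensional ℂ T] (H : T →ₗ[ℂ] T →ₗ⋆[ℂ] ℂ)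
    {F : E → T} {O : Set E} (hF : AnalyticOnNhd ℂ F O) (v : T) :
    AnalyticOnNhd ℂ (fun x => H (F x) v) O := fun x hx =>
  ((H.flip v).toContinuousLinearMap.analyticAt (F x)).comp (hF x hx)

theorem convex_preimage_line {O : Set E} (hO : Convex ℝ O) (x y : E) :
    Convex ℝ {t : ℂ | x + t • y ∈ O} := by
  intro t ht t' ht' a b ha hb hab
  have h := hO ht ht' ha hb hab
  have he : x + (a • t + b • t') • y = a • (x + t • y) + b • (x + t' • y) := by
    have : x = (a + b) • x := by rw [hab, one_smul]
    rw [smul_add, smul_add, add_smul, smul_assoc, smul_assoc]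
    nth_rewrite 1 [this]
    rw [add_smul]
    abel
  change _ ∈ O
  rw [he]
  exact h

end HermitianForms

/-! ### Orthogonal maps on isotropic frames -/

section OrthogonalMaps

variable {E T : Type*} [NormedAddCommGroup E] [NormedSpace ℂ E]
  [NormedAddCommGroup T] [NormedSpace ℂ T]

/-- `F` is a holomorphic map on the open convex set `O` that sends orthogonal vectors to orthogonal
vectors and positive vectors to positive vectors. -/
structure IsLocalOrthogonal (H : E →ₗ[ℂ] E →ₗ⋆[ℂ] ℂ) (H' : T →ₗ[ℂ] T →ₗ⋆[ℂ] ℂ) (O : Set E)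
    (F : E → T) : Prop where
  isOpen : IsOpen O
  convex : Convex ℝ O
  analytic : AnalyticOnNhd ℂ F O
  orth : ∀ x ∈ O, ∀ w ∈ O, H x w = 0 → H' (F x) (F w) = 0
  pos : ∀ x ∈ O, 0 < (H x x).re → 0 < (H' (F x) (F x)).re

variable {H : E →ₗ[ℂ] E →ₗ⋆[ℂ] ℂ} {H' : T →ₗ[ℂ] T →ₗ⋆[ℂ] ℂ} {O : Set E} {F : E → T}

/-- Images of the vectors of an isotropic frame together with a further vector of its span are
dependent, by the bound on the dimension of isotropic subspaces in the target. -/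
theorem IsLocalOrthogonal.dependent_of_isotropic (hF : IsLocalOrthogonal H H' O F) {q : ℕ}
    (hk : NonnegIndexLE H' (q + 2)) {X : Fin (q + 2) → E} (hXO : ∀ i, X i ∈ O)
    (hX : ∀ i j, H (X i) (X j) = 0) {c₀ c₁ : ℂ} (hz : c₀ • X 0 + c₁ • X 1 ∈ O) :
    ¬ LinearIndependent ℂ (Fin.cons (F (c₀ • X 0 + c₁ • X 1)) (fun i => F (X i)) :
      Fin (q + 3) → T) := by
  set z := c₀ • X 0 + c₁ • X 1 with hzdef
  have hzX : ∀ j, H z (X j) = 0 := fun j => by simp [hzdef, hX]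
  have hXz : ∀ j, H (X j) z = 0 := fun j => by simp [hzdef, hX]
  have hzz : H z z = 0 := by
    nth_rewrite 1 [hzdef]
    simp [hXz]
  have hall : ∀ i j : Fin (q + 3), H' ((Fin.cons (F z) (fun i => F (X i)) : Fin (q + 3) → T) i)
      ((Fin.cons (F z) (fun i => F (X i)) : Fin (q + 3) → T) j) = 0 := by
    intro i j
    refine Fin.cases ?_ (fun i => ?_) i <;> refine Fin.cases ?_ (fun j => ?_) j
    · simpa using hF.orth _ hz _ hz hzz
    · simpa using hF.orth _ hz _ (hXO j) (hzX j)
    · simpa using hF.orth _ (hXO i) _ hz (hXz i)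
    · simpa using hF.orth _ (hXO i) _ (hXO j) (hX i j)
  exact hk _ (fun i j _ => hall i j) (fun i => by rw [hall i i]; simp)

/-- A frame `X` close to an isotropic frame `X₀` lies on a complex line of frames
`μ ↦ X + μ Y` whose members with `Re μ = -1/2` are isotropic. Here `Y` is the component of `X` in
the span of an isotropic frame `A` dual to `X₀`, along the orthogonal complement of `X`. Since
`{Re μ = -1/2}` is a set of uniqueness, linear dependence spreads from isotropic frames to `X`. -/
theorem IsLocalOrthogonal.eventually_dependent [FiniteDimensional ℂ T] (hH : IsHermitianForm H)
    (hHc : Continuous fun p : E × E => H p.1 p.2)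
    (hF : IsLocalOrthogonal H H' O F) {q : ℕ} (hk : NonnegIndexLE H' (q + 2))
    {X₀ A : Fin (q + 2) → E} (hXO : ∀ i, X₀ i ∈ O) (hX : ∀ i j, H (X₀ i) (X₀ j) = 0)
    (hA : ∀ i j, H (A i) (A j) = 0) (hAX : ∀ i j, H (A i) (X₀ j) = if i = j then 1 else 0)
    {c₀ c₁ : ℂ} (hz : c₀ • X₀ 0 + c₁ • X₀ 1 ∈ O) :
    ∀ᶠ X in 𝓝 X₀, ¬ LinearIndependent ℂ (Fin.cons (F (c₀ • X 0 + c₁ • X 1)) (fun i => F (X i)) :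
      Fin (q + 3) → T) := by
  let S : (Fin (q + 2) → E) → Matrix (Fin (q + 2)) (Fin (q + 2)) ℂ :=
    fun X => Matrix.of fun i j => H (X i) (X j)
  let Q : (Fin (q + 2) → E) → Matrix (Fin (q + 2)) (Fin (q + 2)) ℂ :=
    fun X => Matrix.of fun i j => H (A i) (X j)
  let C := fun X => S X * (Q X)⁻¹
  let Y : (Fin (q + 2) → E) → (Fin (q + 2) → E) := fun X i => ∑ l, C X i l • A l
  have hSc : Continuous S := by
    refine continuous_matrix fun i j => ?_
    exact hHc.comp (f := fun X : Fin (q + 2) → E => (X i, X j)) (by fun_prop)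
  have hQc : Continuous Q := by
    refine continuous_matrix fun i j => ?_
    exact hHc.comp (f := fun X : Fin (q + 2) → E => (A i, X j)) (by fun_prop)
  have hQ0 : Q X₀ = 1 := by
    ext i j
    simp [Q, hAX, Matrix.one_apply]
  have hS0 : S X₀ = 0 := by
    ext i j
    simp [S, hX]
  have hdet : (Q X₀).det ≠ 0 := by simp [hQ0]
  have hCc : ContinuousAt C X₀ := by
    have h1 : ContinuousAt (fun X => (Q X).det) X₀ := hQc.matrix_det.continuousAt
    have h2 : ContinuousAt (fun X => (Q X)⁻¹) X₀ := by
      simp only [Matrix.inv_def, Ring.inverse_eq_inv']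
      exact (h1.inv₀ hdet).smul hQc.matrix_adjugate.continuousAt
    exact (hSc.continuousAt.mul h2)
  have hYc : ContinuousAt Y X₀ := by
    refine continuousAt_pi.mpr fun i => ?_
    refine tendsto_finsetSum _ fun l _ => ?_
    have : ContinuousAt (fun X => C X i l) X₀ :=
      continuousAt_pi.mp (continuousAt_pi.mp hCc i) l
    exact this.smul continuousAt_const
  have hY0 : Y X₀ = 0 := by
    ext i
    simp [Y, C, hS0]
  have hev1 : ∀ᶠ X in 𝓝 X₀, (∀ i, X i ∈ O) ∧ c₀ • X 0 + c₁ • X 1 ∈ O := by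
    refine (eventually_all.mpr fun i => ?_).and ?_
    · exact (continuous_apply i).continuousAt.eventually_mem (hF.isOpen.mem_nhds (hXO i))
    · have : Continuous fun X : Fin (q + 2) → E => c₀ • X 0 + c₁ • X 1 := by fun_prop
      exact this.continuousAt.eventually_mem (hF.isOpen.mem_nhds hz)
  have hev2 : ∀ᶠ X in 𝓝 X₀, (∀ i, (X + (-1 / 2 : ℂ) • Y X) i ∈ O) ∧
      c₀ • (X + (-1 / 2 : ℂ) • Y X) 0 + c₁ • (X + (-1 / 2 : ℂ) • Y X) 1 ∈ O := by
    have ht : Tendsto (fun X => X + (-1 / 2 : ℂ) • Y X) (𝓝 X₀) (𝓝 X₀) := by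
      have h3 : Tendsto (fun X => X + (-1 / 2 : ℂ) • Y X) (𝓝 X₀) (𝓝 (X₀ + (-1 / 2 : ℂ) • Y X₀)) :=
        tendsto_id.add (hYc.tendsto.const_smul (-1 / 2 : ℂ))
      rwa [hY0, smul_zero, add_zero] at h3
    exact ht.eventually hev1
  have hev3 : ∀ᶠ X in 𝓝 X₀, (Q X).det ≠ 0 := hQc.matrix_det.continuousAt.eventually_ne hdet
  filter_upwards [hev1, hev2, hev3] with X h1 h2 h3
  have hYX : ∀ i j, H (Y X i) (X j) = H (X i) (X j) := by
    intro i j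
    have hCQ : C X * Q X = S X := by
      simp only [C]
      rw [Matrix.mul_assoc, Matrix.nonsing_inv_mul _ (isUnit_iff_ne_zero.mpr h3), Matrix.mul_one]
    have := congrFun (congrFun hCQ i) j
    rw [Matrix.mul_apply] at this
    simp only [Y]
    rw [form_sum_left]
    exact this
  have hAY : ∀ i j, H (A i) (Y X j) = 0 := fun i j => by simp [Y, map_sum, hA]
  have hYY : ∀ i j, H (Y X i) (Y X j) = 0 := by
    intro i j
    nth_rewrite 1 [show Y X i = ∑ l, C X i l • A l from rfl]
    rw [form_sum_left]
    simp [hAY]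
  have hXY : ∀ i j, H (X i) (Y X j) = H (X i) (X j) := by
    intro i j
    rw [← hH, hYX, hH]
  -- The Gram matrix of `X + μ Y` is `(1 + 2 Re μ)` times that of `X`.
  have hgram : ∀ (μ : ℂ) i j, H ((X + μ • Y X) i) ((X + μ • Y X) j) =
      (1 + 2 * (μ.re : ℂ)) * H (X i) (X j) := by
    intro μ i j
    have hμ : (starRingEnd ℂ) μ = 2 * (μ.re : ℂ) - μ := by
      have := Complex.add_conj μ
      push_cast at this
      linear_combination this
    simp only [Pi.add_apply, Pi.smul_apply, map_add, map_smul, LinearMap.add_apply,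
      LinearMap.smul_apply, LinearMap.map_smulₛₗ, hYX, hXY, hYY, smul_eq_mul, hμ]
    ring
  let V : Set ℂ := {μ | (∀ i, X i + μ • Y X i ∈ O) ∧
    (c₀ • X 0 + c₁ • X 1) + μ • (c₀ • Y X 0 + c₁ • Y X 1) ∈ O}
  have hzμ : ∀ μ : ℂ, (c₀ • X 0 + c₁ • X 1) + μ • (c₀ • Y X 0 + c₁ • Y X 1) =
      c₀ • (X + μ • Y X) 0 + c₁ • (X + μ • Y X) 1 := by
    intro μ
    simp only [Pi.add_apply, Pi.smul_apply]
    module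
  have hVo : IsOpen V := by
    have e : V = (⋂ i, {μ : ℂ | X i + μ • Y X i ∈ O}) ∩
        {μ | (c₀ • X 0 + c₁ • X 1) + μ • (c₀ • Y X 0 + c₁ • Y X 1) ∈ O} := by
      ext μ; simp [V]
    rw [e]
    refine (isOpen_iInter_of_finite fun i => ?_).inter ?_
    · exact hF.isOpen.preimage (by fun_prop)
    · exact hF.isOpen.preimage (by fun_prop)
  have hVc : Convex ℝ V := by
    have e : V = (⋂ i, {μ : ℂ | X i + μ • Y X i ∈ O}) ∩
        {μ | (c₀ • X 0 + c₁ • X 1) + μ • (c₀ • Y X 0 + c₁ • Y X 1) ∈ O} := by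
      ext μ; simp [V]
    rw [e]
    exact (convex_iInter fun i => convex_preimage_line hF.convex _ _).inter
      (convex_preimage_line hF.convex _ _)
  have hm : (-1 / 2 : ℂ) ∈ V := ⟨fun i => by simpa using h2.1 i, by rw [hzμ]; exact h2.2⟩
  have h0 : (0 : ℂ) ∈ V := ⟨fun i => by simpa using h1.1 i, by simpa using h1.2⟩
  have hline : ∀ x y : E, (∀ μ ∈ V, x + μ • y ∈ O) →
      AnalyticOnNhd ℂ (fun μ : ℂ => F (x + μ • y)) V := fun x y hxy μ hμ =>
    AnalyticAt.fun_comp (hF.analytic _ (hxy μ hμ)) (by fun_prop)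
  let G : Fin (q + 3) → ℂ → T := Fin.cons
    (fun μ => F ((c₀ • X 0 + c₁ • X 1) + μ • (c₀ • Y X 0 + c₁ • Y X 1)))
    (fun i μ => F (X i + μ • Y X i))
  have hGe : ∀ μ, (fun i => G i μ) = (Fin.cons
      (F ((c₀ • X 0 + c₁ • X 1) + μ • (c₀ • Y X 0 + c₁ • Y X 1)))
      (fun i => F (X i + μ • Y X i)) : Fin (q + 3) → T) := by
    intro μ
    ext i
    refine Fin.cases ?_ (fun i => ?_) i <;> simp [G]
  have hGa : ∀ i, AnalyticOnNhd ℂ (G i) V := by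
    intro i
    refine Fin.cases ?_ (fun i => ?_) i
    · exact hline _ _ fun μ hμ => hμ.2
    · exact hline _ _ fun μ hμ => hμ.1 i
  have hfin := not_linearIndependent_of_uniqueness (S := {μ ∈ V | μ.re = (-1 / 2 : ℂ).re}) hGa
    (fun h hh hS => eq_zero_of_eq_zero_on_vertical_line hVo hVc.isPreconnected hh hm
      fun t ht hre => hS t ⟨ht, hre⟩)
    (fun μ hμ => by
      rw [hGe, hzμ]
      refine hF.dependent_of_isotropic hk (X := X + μ • Y X) hμ.1.1 (fun i j => ?_)
        (by rw [← hzμ]; exact hμ.1.2)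
      have hre : μ.re = -1 / 2 := by
        rw [hμ.2]; norm_num
      rw [hgram, hre]
      push_cast
      ring) 0 h0
  rw [hGe] at hfin
  simpa using hfin

end OrthogonalMaps

/-! ### Planes are mapped into planes -/

section OrthogonalMaps

variable {E T : Type*} [NormedAddCommGroup E] [NormedSpace ℂ E]
  [NormedAddCommGroup T] [NormedSpace ℂ T] [FiniteDimensional ℂ T]
  {H : E →ₗ[ℂ] E →ₗ⋆[ℂ] ℂ} {H' : T →ₗ[ℂ] T →ₗ⋆[ℂ] ℂ} {O : Set E} {F : E → T}

/-- The positive vectors `e i` and the negative vectors `v i` form an orthonormal family of the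
Hermitian form `H`. -/
structure IsHyperbolicFrame (H : E →ₗ[ℂ] E →ₗ⋆[ℂ] ℂ) {k : ℕ} (e v : Fin k → E) : Prop where
  pos : ∀ i j, H (e i) (e j) = if i = j then 1 else 0
  neg : ∀ i j, H (v i) (v j) = if i = j then -1 else 0
  orth : ∀ i j, H (e i) (v j) = 0
  orth' : ∀ i j, H (v i) (e j) = 0

theorem cons_comp_apply {E T Q : Type*} {n : ℕ} (F : E → T) (z : Q → E) (x : Q → Fin n → E)
    (c : Q) :
    (fun i => (Fin.cons (fun c => F (z c)) (fun i c => F (x c i)) : Fin (n + 1) → Q → T) i c) =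
      (Fin.cons (F (z c)) (fun i => F (x c i)) : Fin (n + 1) → T) := by
  ext i
  refine Fin.cases ?_ (fun i => ?_) i <;> simp

/-- `F` sends a frame together with a vector in the span of its first two members to linearly
dependent vectors: the statement spreads from a neighbourhood of one isotropic frame by analytic
continuation, first in the frame and then in the coefficients of the last vector. -/
theorem IsLocalOrthogonal.dependent (hH : IsHermitianForm H)
    (hHc : Continuous fun p : E × E => H p.1 p.2)
    (hF : IsLocalOrthogonal H H' O F) {q : ℕ} (hk : NonnegIndexLE H' (q + 2))
    {e v : Fin (q + 2) → E} (hev : IsHyperbolicFrame H e v)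
    (hevO : ∀ i, (1 / 2 : ℂ) • (e i + v i) ∈ O)
    {X : Fin (q + 2) → E} (hXO : ∀ i, X i ∈ O) {c₀ c₁ : ℂ} (hz : c₀ • X 0 + c₁ • X 1 ∈ O) :
    ¬ LinearIndependent ℂ (Fin.cons (F (c₀ • X 0 + c₁ • X 1)) (fun i => F (X i)) :
      Fin (q + 3) → T) := by
  let X₀ : Fin (q + 2) → E := fun i => (1 / 2 : ℂ) • (e i + v i)
  let A : Fin (q + 2) → E := fun i => e i - v i
  have hX₀ : ∀ i j, H (X₀ i) (X₀ j) = 0 := by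
    intro i j
    simp only [X₀, map_add, map_smul, LinearMap.add_apply, LinearMap.smul_apply,
      LinearMap.map_smulₛₗ, hev.pos, hev.neg, hev.orth, hev.orth']
    split_ifs <;> simp
  have hA : ∀ i j, H (A i) (A j) = 0 := by
    intro i j
    simp only [A, map_sub, LinearMap.sub_apply, hev.pos, hev.neg, hev.orth, hev.orth']
    split_ifs <;> simp
  have hAX : ∀ i j, H (A i) (X₀ j) = if i = j then 1 else 0 := by
    intro i j
    simp only [A, X₀, map_add, map_sub, LinearMap.sub_apply,
      LinearMap.map_smulₛₗ, hev.pos, hev.neg, hev.orth, hev.orth']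
    split_ifs
    · simp only [map_div₀, map_one, map_ofNat, smul_eq_mul]; norm_num
    · simp
  have hstep : ∀ c : ℂ × ℂ, c.1 • X₀ 0 + c.2 • X₀ 1 ∈ O → ∀ X : Fin (q + 2) → E,
      (∀ i, X i ∈ O) → c.1 • X 0 + c.2 • X 1 ∈ O →
      ¬ LinearIndependent ℂ (Fin.cons (F (c.1 • X 0 + c.2 • X 1)) (fun i => F (X i)) :
        Fin (q + 3) → T) := by
    intro c hc X hX hXc
    let V : Set (Fin (q + 2) → E) := {X | (∀ i, X i ∈ O) ∧ c.1 • X 0 + c.2 • X 1 ∈ O}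
    have hVc : Convex ℝ V := by
      intro X hX X' hX' a b ha hb hab
      refine ⟨fun i => hF.convex (hX.1 i) (hX'.1 i) ha hb hab, ?_⟩
      have := hF.convex hX.2 hX'.2 ha hb hab
      convert this using 1
      simp only [Pi.add_apply, Pi.smul_apply, smul_add, smul_comm _ a, smul_comm _ b]
      abel
    have hproj : ∀ i (X : Fin (q + 2) → E), AnalyticAt ℂ (fun X : Fin (q + 2) → E => X i) X :=
      fun i X => (ContinuousLinearMap.proj (R := ℂ) (φ := fun _ : Fin (q + 2) => E) i).analyticAt X
    have hfin := not_linearIndependent_of_eventually hVc (x₀ := X₀) ⟨hevO, hc⟩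
      (G := Fin.cons (fun X => F (c.1 • X 0 + c.2 • X 1)) (fun i X => F (X i)))
      (fun i => by
        refine Fin.cases ?_ (fun i => ?_) i
        · intro X hX
          rw [Fin.cons_zero]
          exact AnalyticAt.fun_comp (hF.analytic _ hX.2)
            (((hproj 0 X).const_smul).add ((hproj 1 X).const_smul))
        · intro X hX
          rw [Fin.cons_succ]
          exact AnalyticAt.fun_comp (hF.analytic _ (hX.1 i)) (hproj i X))
      (by
        filter_upwards [hF.eventually_dependent hH hHc hk hevO hX₀ hA hAX hc] with X hX
        rwa [cons_comp_apply F (fun X => c.1 • X 0 + c.2 • X 1) (fun X => X) X]) X ⟨hX, hXc⟩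
    rwa [cons_comp_apply F (fun X => c.1 • X 0 + c.2 • X 1) (fun X => X) X] at hfin
  let W : Set (ℂ × ℂ) := {c | c.1 • X 0 + c.2 • X 1 ∈ O}
  have hmid : ∀ Y : Fin (q + 2) → E, (∀ i, Y i ∈ O) →
      (1 / 2 : ℂ) • Y 0 + (1 / 2 : ℂ) • Y 1 ∈ O := by
    intro Y hY
    have := hF.convex (hY 0) (hY 1) (a := 1 / 2) (b := 1 / 2) (by norm_num) (by norm_num)
      (by norm_num)
    convert this using 2 <;>
    · rw [← Complex.coe_smul]; norm_num
  have hWc : Convex ℝ W := by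
    intro c hc c' hc' a b ha hb hab
    have := hF.convex hc hc' ha hb hab
    change _ ∈ O
    convert this using 1
    simp only [Prod.fst_add, Prod.snd_add, Prod.smul_fst, Prod.smul_snd, add_smul, smul_add,
      smul_assoc]
    abel
  have hfin := not_linearIndependent_of_eventually hWc (x₀ := (1 / 2, 1 / 2)) (hmid X hXO)
    (G := Fin.cons (fun c => F (c.1 • X 0 + c.2 • X 1)) (fun i _ => F (X i)))
    (fun i => by
      refine Fin.cases ?_ (fun i => ?_) i
      · intro c hc
        rw [Fin.cons_zero]
        exact AnalyticAt.fun_comp (hF.analytic _ hc)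
          ((analyticAt_fst.smul analyticAt_const).add (analyticAt_snd.smul analyticAt_const))
      · exact analyticOnNhd_const)
    (by
      have h1 : ∀ Y : Fin (q + 2) → E, (∀ i, Y i ∈ O) → ∀ᶠ c : ℂ × ℂ in 𝓝 (1 / 2, 1 / 2),
          c.1 • Y 0 + c.2 • Y 1 ∈ O := by
        intro Y hY
        have hc : Continuous fun c : ℂ × ℂ => c.1 • Y 0 + c.2 • Y 1 := by fun_prop
        exact hc.continuousAt.eventually_mem (hF.isOpen.mem_nhds (hmid Y hY))
      filter_upwards [h1 X hXO, h1 X₀ hevO] with c hc hc'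
      rw [cons_comp_apply F (fun c => c.1 • X 0 + c.2 • X 1) (fun _ => X) c]
      exact hstep c hc' X hXO hc) (c₀, c₁) hz
  rwa [cons_comp_apply F (fun c => c.1 • X 0 + c.2 • X 1) (fun _ => X) (c₀, c₁)] at hfin

/-- The image of `F` is not contained in a subspace spanned by few of its vectors. Otherwise the
image would span a positive definite space, so that `F` would vanish at all null vectors, a set of
uniqueness. -/
theorem IsLocalOrthogonal.exists_notMem_span (hF : IsLocalOrthogonal H H' O F) {k : ℕ}
    (hk0 : 0 < k) {e v : Fin k → E} (hev : IsHyperbolicFrame H e v)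
    (hevO : ∀ i, (1 / 2 : ℂ) • (e i + v i) ∈ O) (heO : ∀ i, e i ∈ O)
    {m : ℕ} (hm : m ≤ k) (y : Fin m → T) :
    ∃ x ∈ O, F x ∉ Submodule.span ℂ (Set.range y) := by
  by_contra! hcon
  have horth : ∀ i j, i ≠ j → H' (F (e i)) (F (e j)) = 0 := fun i j hij =>
    hF.orth _ (heO i) _ (heO j) (by simp [hev.pos, hij])
  have hpos : ∀ i, 0 < (H' (F (e i)) (F (e i))).re := fun i =>
    hF.pos _ (heO i) (by simp [hev.pos])
  have hne : ∀ i, H' (F (e i)) (F (e i)) ≠ 0 := fun i h => by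
    have := hpos i
    simp [h] at this
  have hli := linearIndependent_of_orthogonal horth hne
  have hspan : Submodule.span ℂ (Set.range fun i => F (e i)) = Submodule.span ℂ (Set.range y) := by
    refine Submodule.eq_of_le_of_finrank_le ?_ ?_
    · rw [Submodule.span_le]
      rintro _ ⟨i, rfl⟩
      exact hcon _ (heO i)
    · rw [finrank_span_eq_card hli]
      refine (finrank_range_le_card y).trans ?_
      simpa using hm
  have hnull : ∀ x ∈ O, H x x = 0 → F x = 0 := by
    intro x hx hxx
    have hmem := hcon x hx
    rw [← hspan] at hmem
    obtain ⟨c, hc⟩ := (Submodule.mem_span_range_iff_exists_fun ℂ).mp hmem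
    have h0 := hF.orth x hx x hx hxx
    have h1 : H' (F x) (F x) = ∑ i, ((‖c i‖ ^ 2 : ℝ) : ℂ) * H' (F (e i)) (F (e i)) := by
      nth_rewrite 2 [← hc]
      rw [map_sum]
      refine Finset.sum_congr rfl fun i _ => ?_
      rw [LinearMap.map_smulₛₗ, ← hc, form_sum_orthogonal H' horth, smul_eq_mul, ← mul_assoc,
        Complex.conj_mul']
      push_cast
      ring
    rw [h0] at h1
    have h2 : ∑ i, ‖c i‖ ^ 2 * (H' (F (e i)) (F (e i))).re = 0 := by
      have := congrArg Complex.re h1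
      simp only [Complex.zero_re, Complex.re_sum, Complex.re_ofReal_mul] at this
      exact this.symm
    have h3 := (Finset.sum_eq_zero_iff_of_nonneg
      (fun i _ => mul_nonneg (sq_nonneg _) (hpos i).le)).mp h2
    rw [← hc]
    refine Finset.sum_eq_zero fun i hi => ?_
    have h4 := h3 i hi
    have : c i = 0 := by simpa [(hpos i).ne'] using h4
    rw [this, zero_smul]
  -- On the line through the null vector `(e + v) / 2` and the positive vector `e`, the null
  -- vectors are those with purely imaginary parameter.
  let i₀ : Fin k := ⟨0, hk0⟩
  let x₀ := (1 / 2 : ℂ) • (e i₀ + v i₀)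
  let y₀ := (1 / 2 : ℂ) • (e i₀ - v i₀)
  have hsum : x₀ + (1 : ℂ) • y₀ = e i₀ := by simp only [x₀, y₀]; module
  have hVo : IsOpen {t : ℂ | x₀ + t • y₀ ∈ O} := hF.isOpen.preimage (by fun_prop)
  have h := eq_zero_of_eq_zero_on_vertical_line hVo
    (convex_preimage_line hF.convex x₀ y₀).isPreconnected
    (h := fun t => H' (F (x₀ + t • y₀)) (F (e i₀)))
    (fun t ht => by
      exact AnalyticAt.fun_comp (analyticOnNhd_form_left H' hF.analytic _ _ ht)
        (f := fun t : ℂ => x₀ + t • y₀) (by fun_prop))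
    (t₀ := 0) (by rw [Set.mem_ofPred_eq, zero_smul, add_zero]; exact hevO i₀)
    (fun t ht hre => by
      have hconj : (starRingEnd ℂ) t = -t := by
        have := Complex.add_conj t
        rw [hre] at this
        simp only [Complex.zero_re, mul_zero, Complex.ofReal_zero] at this
        linear_combination this
      have : H (x₀ + t • y₀) (x₀ + t • y₀) = 0 := by
        simp only [x₀, y₀, map_add, map_sub, map_smul, LinearMap.add_apply, LinearMap.sub_apply,
          LinearMap.smul_apply, LinearMap.map_smulₛₗ, hev.pos, hev.neg, hev.orth, hev.orth',
          smul_eq_mul, hconj, if_true, map_div₀, map_one, map_ofNat]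
        ring
      rw [hnull _ ht this]
      simp) 1 (by rw [Set.mem_ofPred_eq, hsum]; exact heO i₀)
  simp only [hsum] at h
  exact hne i₀ h

/-- `F` maps planes, that is two-dimensional subspaces, into planes: three independent images from
a plane could be completed, one vector at a time, to a family contradicting
`IsLocalOrthogonal.dependent`. -/
theorem IsLocalOrthogonal.dependent_of_plane (hH : IsHermitianForm H)
    (hHc : Continuous fun p : E × E => H p.1 p.2)
    (hF : IsLocalOrthogonal H H' O F) {q : ℕ} (hk : NonnegIndexLE H' (q + 2))
    {e v : Fin (q + 2) → E} (hev : IsHyperbolicFrame H e v)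
    (hevO : ∀ i, (1 / 2 : ℂ) • (e i + v i) ∈ O) (heO : ∀ i, e i ∈ O)
    {a b z : E} (ha : a ∈ O) (hb : b ∈ O) (hzO : z ∈ O) (hz : z ∈ Submodule.span ℂ {a, b}) :
    ¬ LinearIndependent ℂ ![F a, F b, F z] := by
  have hdesc : ∀ d j : ℕ, j + d = q → ∀ X : Fin (j + 2) → E, (∀ i, X i ∈ O) → ∀ c₀ c₁ : ℂ,
      c₀ • X 0 + c₁ • X 1 ∈ O →
      ¬ LinearIndependent ℂ (Fin.cons (F (c₀ • X 0 + c₁ • X 1)) (fun i => F (X i)) :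
        Fin (j + 3) → T) := by
    intro d
    induction d with
    | zero =>
      rintro j rfl X hX c₀ c₁ hc
      exact hF.dependent hH hHc hk hev hevO hX hc
    | succ d ih =>
      intro j hj X hX c₀ c₁ hc hli
      obtain ⟨y, hyO, hy⟩ := hF.exists_notMem_span (by omega) hev hevO heO
        (m := j + 3) (by omega) (Fin.cons (F (c₀ • X 0 + c₁ • X 1)) (fun i => F (X i)))
      let X' : Fin (j + 1 + 2) → E := Fin.snoc X y
      have e0 : X' 0 = X 0 := by
        have := Fin.snoc_castSucc (α := fun _ => E) y X 0
        exact this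
      have e1 : X' 1 = X 1 := by
        have := Fin.snoc_castSucc (α := fun _ => E) y X 1
        exact this
      refine ih (j + 1) (by omega) X' (fun i => ?_) c₀ c₁ (by rw [e0, e1]; exact hc) ?_
      · refine Fin.lastCases ?_ (fun i => ?_) i
        · simpa [X'] using hyO
        · simpa [X'] using hX i
      · rw [e0, e1]
        have e2 : (Fin.cons (F (c₀ • X 0 + c₁ • X 1)) (fun i => F (X' i)) : Fin (j + 1 + 3) → T) =
            Fin.snoc (Fin.cons (F (c₀ • X 0 + c₁ • X 1)) (fun i => F (X i)) : Fin (j + 3) → T)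
              (F y) := by
          have e3 : (fun i => F (X' i)) =
              (Fin.snoc (fun i => F (X i)) (F y) : Fin (j + 3) → T) := by
            ext i
            refine Fin.lastCases ?_ (fun i => ?_) i <;> simp [X']
          rw [e3]
          exact Fin.cons_snoc_eq_snoc_cons (F (c₀ • X 0 + c₁ • X 1)) (fun i => F (X i)) (F y)
        rw [e2, linearIndependent_finSnoc]
        exact ⟨hli, hy⟩
  obtain ⟨c₀, c₁, rfl⟩ := Submodule.mem_span_pair.mp hz
  have h := hdesc q 0 (by omega) ![a, b] (fun i => by fin_cases i <;> simpa) c₀ c₁ (by simpa)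
  intro hli
  apply h
  have h2 := hli.comp (![2, 0, 1] : Fin 3 → Fin 3) (by decide)
  convert h2 using 1
  ext i
  fin_cases i <;> rfl

/-! ### The form pulled back by an orthogonal map has rank one -/

/-- A holomorphic map `F` sending planes to planes agrees, on the span of three vectors `x l` with
independent images, with a linear map up to a scalar function. In coordinates `ξ` with respect to
the `x l`, the linear map is `ξ ↦ ∑ γ l ξ l F (x l)` and the scalar is `g ξ / ξ 0`. -/
theorem exists_linear_of_dependent_of_plane (hO : IsOpen O) (hOc : Convex ℝ O)
    (hF : AnalyticOnNhd ℂ F O)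
    (hline : ∀ a ∈ O, ∀ b ∈ O, ∀ z ∈ O, z ∈ Submodule.span ℂ {a, b} →
      ¬ LinearIndependent ℂ ![F a, F b, F z])
    {x : Fin 3 → E} (hx : ∀ l, x l ∈ O) (hli : LinearIndependent ℂ (fun l => F (x l))) :
    ∃ (γ₁ γ₂ : ℂ) (g : (Fin 3 → ℂ) → ℂ), g (Pi.single 0 1) = 1 ∧
      ContinuousAt g (Pi.single 0 1) ∧
      ∀ ξ : Fin 3 → ℂ, ∑ l, ξ l • x l ∈ O →
        ξ 0 • F (∑ l, ξ l • x l) =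
          g ξ • (ξ 0 • F (x 0) + (γ₁ * ξ 1) • F (x 1) + (γ₂ * ξ 2) • F (x 2)) := by
  let L : (Fin 3 → ℂ) →ₗ[ℂ] E := Fintype.linearCombination ℂ x
  have hL : ∀ ξ, L ξ = ∑ l, ξ l • x l := fun ξ => Fintype.linearCombination_apply ℂ x ξ
  have hLs : ∀ l, L (Pi.single l 1) = x l := fun l => by
    simp only [L, Fintype.linearCombination_apply_single, one_smul]
  let O' : Set (Fin 3 → ℂ) := L ⁻¹' O
  have hO' : IsOpen O' := hO.preimage L.continuous_of_finiteDimensional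
  have hOc' : Convex ℝ O' := hOc.linear_preimage (L.restrictScalars ℝ)
  have hs : ∀ l, Pi.single l 1 ∈ O' := fun l => by
    change L _ ∈ O
    rw [hLs]; exact hx l
  obtain ⟨Θ, hΘ⟩ := (Fintype.linearCombination ℂ (fun l => F (x l))).exists_leftInverse_of_injective
    (LinearMap.ker_eq_bot.mpr (linearIndependent_iff_injective_fintypeLinearCombination.mp hli))
  have hΘs : ∀ l, Θ (F (x l)) = Pi.single l 1 := by
    intro l
    have := LinearMap.congr_fun hΘ (Pi.single l 1)
    simpa only [LinearMap.comp_apply, Fintype.linearCombination_apply_single, one_smul,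
      LinearMap.id_apply] using this
  have hFL : AnalyticOnNhd ℂ (fun ξ => F (L ξ)) O' := fun ξ hξ =>
    AnalyticAt.fun_comp (hF _ hξ) (L.toContinuousLinearMap.analyticAt ξ)
  -- The plane version applies to every linear map dual to the three images.
  have hdual : ∀ Ψ : T →ₗ[ℂ] (Fin 3 → ℂ), (∀ l, Ψ (F (x l)) = Pi.single l 1) →
      ∀ j, j ≠ 0 → ∃ γ : ℂ, ∀ ξ ∈ O', ξ 0 * Ψ (F (L ξ)) j = γ * ξ j * Ψ (F (L ξ)) 0 := by
    intro Ψ hΨ j hj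
    obtain ⟨k, hk0, hkj⟩ : ∃ k : Fin 3, k ≠ 0 ∧ j ≠ k := by revert j; decide
    refine exists_diagonal_of_collinear (G := fun ξ => Ψ (F (L ξ))) hO' hOc' (fun ξ hξ =>
      AnalyticAt.fun_comp (Ψ.toContinuousLinearMap.analyticAt _) (hFL ξ hξ)) hs
      (fun l => by rw [hLs, hΨ]) (fun a ha b hb c hc habc hli' => ?_) hj.symm hk0.symm hkj
    refine hline (L a) ha (L b) hb (L c) hc ?_ ?_
    · obtain ⟨s, t, rfl⟩ := Submodule.mem_span_pair.mp habc
      exact Submodule.mem_span_pair.mpr ⟨s, t, by simp⟩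
    · refine LinearIndependent.of_comp Ψ ?_
      convert hli' using 1
      ext i
      fin_cases i <;> rfl
  obtain ⟨γ₁, hγ₁⟩ := hdual Θ hΘs 1 (by decide)
  obtain ⟨γ₂, hγ₂⟩ := hdual Θ hΘs 2 (by decide)
  have hg : ContinuousAt (fun ξ => Θ (F (L ξ)) 0) (Pi.single 0 1) := by
    have h1 : ContinuousAt (fun ξ => Θ (F (L ξ))) (Pi.single 0 1) :=
      Θ.continuous_of_finiteDimensional.continuousAt.comp (hFL _ (hs 0)).continuousAt
    exact continuousAt_pi.mp h1 0
  refine ⟨γ₁, γ₂, fun ξ => Θ (F (L ξ)) 0, ?_, hg, ?_⟩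
  · simp [hLs, hΘs]
  -- The component of `F` transverse to the span of the three images vanishes: adding it to
  -- one of the coordinates of `Θ` gives another dual map.
  let P : T →ₗ[ℂ] T := LinearMap.id - (Fintype.linearCombination ℂ (fun l => F (x l))) ∘ₗ Θ
  have hP : ∀ l, P (F (x l)) = 0 := by
    intro l
    simp only [P, LinearMap.sub_apply, LinearMap.id_apply, LinearMap.comp_apply, hΘs,
      Fintype.linearCombination_apply_single, one_smul, sub_self]
  have htrans : ∀ θ : Module.Dual ℂ T, ∀ ξ ∈ O', ξ 0 * θ (P (F (L ξ))) = 0 := by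
    intro θ
    have hβ : ∀ j, j ≠ 0 → ∃ β : ℂ, ∀ ξ ∈ O', ξ 0 * θ (P (F (L ξ))) = β * ξ j * Θ (F (L ξ)) 0 := by
      intro j hj
      obtain ⟨γ, hγ⟩ := hdual Θ hΘs j hj
      obtain ⟨γ', hγ'⟩ := hdual (Θ + (LinearMap.single ℂ (fun _ : Fin 3 => ℂ) j) ∘ₗ θ ∘ₗ P)
        (fun l => by simp [hΘs, hP]) j hj
      refine ⟨γ' - γ, fun ξ hξ => ?_⟩
      have h1 := hγ ξ hξ
      have h2 := hγ' ξ hξ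
      simp only [LinearMap.add_apply, LinearMap.comp_apply, LinearMap.coe_single, Pi.add_apply,
        Pi.single_eq_same, Pi.single_eq_of_ne hj.symm, add_zero] at h2
      linear_combination h2 - h1
    obtain ⟨β, hβ1⟩ := hβ 1 (by decide)
    obtain ⟨β', hβ2⟩ := hβ 2 (by decide)
    have hc : Continuous fun t : ℂ => (Pi.single 0 1 + t • Pi.single 1 1 : Fin 3 → ℂ) := by
      fun_prop
    have hev : ∀ᶠ t : ℂ in 𝓝 0, (Pi.single 0 1 + t • Pi.single 1 1 : Fin 3 → ℂ) ∈ O' ∧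
        Θ (F (L (Pi.single 0 1 + t • Pi.single 1 1))) 0 ≠ 0 := by
      have h1 : ∀ᶠ ξ in 𝓝 (Pi.single 0 1 : Fin 3 → ℂ), ξ ∈ O' ∧ Θ (F (L ξ)) 0 ≠ 0 :=
        (hO'.eventually_mem (hs 0)).and (hg.eventually_ne (by simp [hLs, hΘs]))
      have h2 := hc.tendsto 0
      rw [zero_smul, add_zero] at h2
      exact h2.eventually h1
    obtain ⟨t, ⟨ht1, ht2⟩, ht0⟩ := ((hev.filter_mono nhdsWithin_le_nhds).and
      (self_mem_nhdsWithin : ({0}ᶜ : Set ℂ) ∈ 𝓝[≠] 0)).exists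
    have h3 := (hβ1 _ ht1).symm.trans (hβ2 _ ht1)
    have hβ0 : β = 0 := by
      simp only [Pi.add_apply, Pi.smul_apply, Pi.single_eq_same, smul_eq_mul,
        Pi.single_eq_of_ne (show (1 : Fin 3) ≠ 0 by decide),
        Pi.single_eq_of_ne (show (2 : Fin 3) ≠ 0 by decide),
        Pi.single_eq_of_ne (show (2 : Fin 3) ≠ 1 by decide), mul_one, mul_zero, add_zero,
        zero_add, zero_mul] at h3
      exact (mul_eq_zero.mp ((mul_eq_zero.mp h3).resolve_right ht2)).resolve_right ht0
    intro ξ hξ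
    rw [hβ1 ξ hξ, hβ0]
    ring
  intro ξ hξ
  rw [← hL] at hξ ⊢
  have hPz : ξ 0 • P (F (L ξ)) = 0 := by
    by_contra hne
    obtain ⟨θ, hθ⟩ : ∃ θ : Module.Dual ℂ T, θ (ξ 0 • P (F (L ξ))) ≠ 0 := by
      by_contra! hall
      exact hne ((Module.forall_dual_apply_eq_zero_iff ℂ _).mp hall)
    exact hθ (by simpa using htrans θ ξ hξ)
  have hdec : F (L ξ) = P (F (L ξ)) + ∑ l, Θ (F (L ξ)) l • F (x l) := by
    simp [P, Fintype.linearCombination_apply]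
  have h1 := hγ₁ ξ hξ
  have h2 := hγ₂ ξ hξ
  calc ξ 0 • F (L ξ) = ξ 0 • P (F (L ξ)) + ξ 0 • ∑ l, Θ (F (L ξ)) l • F (x l) := by
        nth_rewrite 1 [hdec]; rw [smul_add]
    _ = (ξ 0 * Θ (F (L ξ)) 0) • F (x 0) + (ξ 0 * Θ (F (L ξ)) 1) • F (x 1)
        + (ξ 0 * Θ (F (L ξ)) 2) • F (x 2) := by
        rw [hPz, zero_add, Fin.sum_univ_three]
        module
    _ = _ := by
        rw [h1, h2]
        module

/-- The form `H'(F x, F w)` is, up to the factor `H(x, w)`, of rank one. This is first proved for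
`w` with `F w` outside a plane, where `F` is projectively linear on the span of `w` and two positive
vectors of the frame, and then for all `w` by continuation. -/
theorem IsLocalOrthogonal.rank_one [FiniteDimensional ℂ E] (hH : IsHermitianForm H)
    (hH' : IsHermitianForm H') (hHc : Continuous fun p : E × E => H p.1 p.2)
    (hF : IsLocalOrthogonal H H' O F) {q : ℕ} (hk : NonnegIndexLE H' (q + 2))
    {e v : Fin (q + 2) → E} (hev : IsHyperbolicFrame H e v)
    (hevO : ∀ i, (1 / 2 : ℂ) • (e i + v i) ∈ O) (heO : ∀ i, e i ∈ O) :
    ∀ x ∈ O, ∀ w ∈ O,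
      H' (F x) (F w) * H x (e 0) * H' (F (e 0)) (F (e 0)) * H (e 0) w =
        H' (F (e 0)) (F w) * H' (F x) (F (e 0)) * H x w := by
  have hconj : ∀ x y, (starRingEnd ℂ) (H x y) = H y x := hH
  have hconj' : ∀ x y, (starRingEnd ℂ) (H' x y) = H' y x := hH'
  have hHa : ∀ w : E, AnalyticOnNhd ℂ (fun x => H x w) O := fun w x _ =>
    (H.flip w).toContinuousLinearMap.analyticAt x
  have hKa : ∀ y : T, AnalyticOnNhd ℂ (fun x => H' (F x) y) O :=
    analyticOnNhd_form_left H' hF.analytic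
  have hH01 : H (e 0) (e 1) = 0 := by simp [hev.pos]
  have hH10 : H (e 1) (e 0) = 0 := by simp [hev.pos]
  have hH11 : H (e 1) (e 1) = 1 := by simp [hev.pos]
  have hH00 : H (e 0) (e 0) = 1 := by simp [hev.pos]
  have hli2 : LinearIndependent ℂ ![F (e 0), F (e 1)] := by
    have horth : ∀ i j, i ≠ j → H' (F (e i)) (F (e j)) = 0 := fun i j hij =>
      hF.orth _ (heO i) _ (heO j) (by simp [hev.pos, hij])
    have hli := linearIndependent_of_orthogonal horth (fun i h => by
      have := hF.pos _ (heO i) (by simp [hev.pos])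
      simp [h] at this)
    have := hli.comp (![0, 1] : Fin 2 → Fin (q + 2)) (by
      intro i j hij
      fin_cases i <;> fin_cases j <;> simp_all)
    convert this using 1
    ext i
    fin_cases i <;> rfl
  -- For `w` with image outside a plane, the quotient of the two forms depends on `w` only.
  have hgen : ∀ w ∈ O, F w ∉ Submodule.span ℂ (Set.range ![F (e 0), F (e 1)]) →
      ∃ γ : ℂ, ∀ x ∈ O, H' (F x) (F w) * H x (e 0) * γ = H' (F x) (F (e 0)) * H x w := by
    intro w hw hFw
    have hli3 : LinearIndependent ℂ (fun l => F ((![e 0, e 1, w] : Fin 3 → E) l)) := by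
      have h := linearIndependent_finSnoc.mpr ⟨hli2, hFw⟩
      have he : (fun l => F ((![e 0, e 1, w] : Fin 3 → E) l)) =
          (Fin.snoc ![F (e 0), F (e 1)] (F w) : Fin 3 → T) := by
        ext i
        fin_cases i <;> rfl
      rw [he]
      exact h
    have hxO : ∀ l, (![e 0, e 1, w] : Fin 3 → E) l ∈ O := by
      intro l
      fin_cases l
      · exact heO 0
      · exact heO 1
      · exact hw
    obtain ⟨γ₁, γ₂, g, hg1, hgc, hlin⟩ := exists_linear_of_dependent_of_plane hF.isOpen hF.convex
      hF.analytic (fun a ha b hb z hz hzs =>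
        hF.dependent_of_plane hH hHc hk hev hevO heO ha hb hz hzs) hxO hli3
    simp only [Fin.sum_univ_three, Matrix.cons_val_zero, Matrix.cons_val_one, Matrix.cons_val]
      at hlin
    have hcomb : Continuous fun ξ : Fin 3 → ℂ => ξ 0 • e 0 + ξ 1 • e 1 + ξ 2 • w := by fun_prop
    have hgood : ∀ᶠ ξ in 𝓝 (Pi.single 0 1 : Fin 3 → ℂ),
        ξ 0 • e 0 + ξ 1 • e 1 + ξ 2 • w ∈ O ∧ g ξ ≠ 0 := by
      refine (hcomb.continuousAt.eventually_mem (hF.isOpen.mem_nhds ?_)).and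
        (hgc.eventually_ne (by rw [hg1]; exact one_ne_zero))
      simpa using heO 0
    -- The linear model also respects orthogonality, near the orthogonal pair `e 0`, `e 1`.
    have hmodel : ∀ x ∈ O, ∀ ξ : Fin 3 → ℂ, ξ 0 • e 0 + ξ 1 • e 1 + ξ 2 • w ∈ O → g ξ ≠ 0 →
        ξ 0 * H (e 0) x + ξ 1 * H (e 1) x + ξ 2 * H w x = 0 →
        ξ 0 * H' (F (e 0)) (F x) + γ₁ * ξ 1 * H' (F (e 1)) (F x)
          + γ₂ * ξ 2 * H' (F w) (F x) = 0 := by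
      intro x hx ξ hξ hgξ h0
      have h1 := hF.orth _ hξ x hx (by simpa using h0)
      have h2 := congrArg (fun y => H' y (F x)) (hlin ξ hξ)
      simp only [map_smul, map_add, LinearMap.smul_apply, LinearMap.add_apply, smul_eq_mul, h1,
        mul_zero] at h2
      exact (mul_eq_zero.mp h2.symm).resolve_left hgξ
    have hlocal : ∀ᶠ x in 𝓝 (e 1),
        H' (F x) (F w) * H x (e 0) * (starRingEnd ℂ) γ₂ - H' (F x) (F (e 0)) * H x w = 0 := by
      have hcH : ∀ a : E, Continuous fun x => H a x := fun a =>
        hHc.comp (f := fun x : E => (a, x)) (by fun_prop)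
      have hξc : ContinuousAt (fun x => (Pi.single 0 1 - (H (e 0) x / H (e 1) x) • Pi.single 1 1 :
          Fin 3 → ℂ)) (e 1) := by
        have hq : ContinuousAt (fun x => H (e 0) x / H (e 1) x) (e 1) :=
          (hcH _).continuousAt.div (hcH _).continuousAt (by rw [hH11]; exact one_ne_zero)
        exact continuousAt_const.sub (hq.smul continuousAt_const)
      have h1 : ∀ᶠ x in 𝓝 (e 1), ∀ᶠ ξ in 𝓝 (Pi.single 0 1 -
          (H (e 0) x / H (e 1) x) • Pi.single 1 1 : Fin 3 → ℂ),
          ξ 0 • e 0 + ξ 1 • e 1 + ξ 2 • w ∈ O ∧ g ξ ≠ 0 := by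
        have h2 := hξc.tendsto
        rw [hH01, zero_div, zero_smul, sub_zero] at h2
        exact h2.eventually (eventually_eventually_nhds.mpr hgood)
      filter_upwards [h1, hF.isOpen.mem_nhds (heO 1),
        (hcH (e 1)).continuousAt.eventually_ne (by rw [hH11]; exact one_ne_zero)] with x hx1 hx hx0
      set ξx : Fin 3 → ℂ := Pi.single 0 1 - (H (e 0) x / H (e 1) x) • Pi.single 1 1 with hξx
      let ζ : Fin 3 → ℂ := H w x • Pi.single 0 1 - H (e 0) x • Pi.single 2 1
      have hc : Continuous fun t : ℂ => ξx + t • ζ := by fun_prop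
      have hev2 : ∀ᶠ t : ℂ in 𝓝[≠] 0, (ξx + t • ζ) 0 • e 0 + (ξx + t • ζ) 1 • e 1
          + (ξx + t • ζ) 2 • w ∈ O ∧ g (ξx + t • ζ) ≠ 0 := by
        have h2 := hc.tendsto 0
        rw [zero_smul, add_zero] at h2
        exact (h2.eventually hx1).filter_mono nhdsWithin_le_nhds
      obtain ⟨t, ⟨ht1, ht2⟩, ht0⟩ := (hev2.and
        (self_mem_nhdsWithin : ({0}ᶜ : Set ℂ) ∈ 𝓝[≠] 0)).exists
      have hx2 := hx1.self_of_nhds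
      have m1 := hmodel x hx ξx hx2.1 hx2.2 (by
        simp [hξx]
        field_simp
        ring)
      have m2 := hmodel x hx (ξx + t • ζ) ht1 ht2 (by
        simp [hξx, ζ]
        field_simp
        ring)
      have m3 : t * (H w x * H' (F (e 0)) (F x) - γ₂ * H (e 0) x * H' (F w) (F x)) = 0 := by
        simp [ζ] at m2
        linear_combination m2 - m1
      have m4 := (mul_eq_zero.mp m3).resolve_left ht0
      have m5 := congrArg (starRingEnd ℂ) m4
      simp only [map_sub, map_mul, map_zero, hconj, hconj'] at m5
      linear_combination -m5
    refine ⟨(starRingEnd ℂ) γ₂, fun x hx => sub_eq_zero.mp ?_⟩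
    exact eq_zero_of_eventually_eq_zero hF.convex (heO 1)
      ((((hKa _).mul (hHa _)).mul analyticOnNhd_const).sub ((hKa _).mul (hHa _))) hlocal x hx
  have hgen' : ∀ x ∈ O, ∀ w ∈ O, F w ∉ Submodule.span ℂ (Set.range ![F (e 0), F (e 1)]) →
      H' (F x) (F w) * H x (e 0) * H' (F (e 0)) (F (e 0)) * H (e 0) w =
        H' (F (e 0)) (F w) * H' (F x) (F (e 0)) * H x w := by
    intro x hx w hw hFw
    obtain ⟨γ, hγ⟩ := hgen w hw hFw
    have h1 := hγ x hx
    have h2 := hγ (e 0) (heO 0)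
    rw [hH00] at h2
    linear_combination H' (F (e 0)) (F w) * h1 - H' (F x) (F w) * H x (e 0) * h2
  intro x hx
  obtain ⟨w₀, hw₀, hFw₀⟩ := hF.exists_notMem_span (by omega) hev hevO heO (m := 2) (by omega)
    ![F (e 0), F (e 1)]
  have hloc : ∀ᶠ w in 𝓝 w₀,
      H' (F w) (F x) * H (e 0) x * H' (F (e 0)) (F (e 0)) * H w (e 0) -
        H' (F w) (F (e 0)) * H' (F (e 0)) (F x) * H w x = 0 := by
    have hcl : IsClosed (Submodule.span ℂ (Set.range ![F (e 0), F (e 1)]) : Set T) :=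
      Submodule.closed_of_finiteDimensional _
    filter_upwards [(hF.analytic w₀ hw₀).continuousAt.eventually_mem
      (hcl.isOpen_compl.mem_nhds hFw₀), hF.isOpen.mem_nhds hw₀] with w h1 h2
    have h3 := congrArg (starRingEnd ℂ) (hgen' x hx w h2 h1)
    simp only [map_mul, hconj, hconj'] at h3
    linear_combination h3
  intro w hw
  have h1 := eq_zero_of_eventually_eq_zero hF.convex hw₀
    (((((hKa _).mul analyticOnNhd_const).mul analyticOnNhd_const).mul (hHa _)).sub
      (((hKa _).mul analyticOnNhd_const).mul (hHa _))) hloc w hw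
  have h2 := congrArg (starRingEnd ℂ) h1
  simp only [Pi.sub_apply, map_sub, map_zero, map_mul, hconj, hconj'] at h2
  linear_combination h2

/-! ### Orthogonal maps are linear -/

/-- Near a positive vector of the frame, `F` is a linear isometry up to a scalar function. -/
theorem IsLocalOrthogonal.exists_isometry [FiniteDimensional ℂ E] (hH : IsHermitianForm H)
    (hH' : IsHermitianForm H') (hHc : Continuous fun p : E × E => H p.1 p.2)
    (hF : IsLocalOrthogonal H H' O F) {q : ℕ} (hk : NonnegIndexLE H' (q + 2))
    {e v : Fin (q + 2) → E} (hev : IsHyperbolicFrame H e v)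
    (hevO : ∀ i, (1 / 2 : ℂ) • (e i + v i) ∈ O) (heO : ∀ i, e i ∈ O) :
    ∃ (A : E →ₗ[ℂ] T) (g : E → ℂ), (∀ x w, H' (A x) (A w) = H x w) ∧ AnalyticAt ℂ g (e 0) ∧
      g (e 0) ≠ 0 ∧ ∀ᶠ x in 𝓝 (e 0), F x = g x • A x := by
  have hrank := hF.rank_one hH hH' hHc hk hev hevO heO
  have hH00 : H (e 0) (e 0) = 1 := by simp [hev.pos]
  have hκpos := hF.pos _ (heO 0) (by simp [hH00])
  have hκ := hH'.self_eq_re (F (e 0))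
  set κ : ℝ := (H' (F (e 0)) (F (e 0))).re with hκdef
  let ρ : ℝ := √κ
  have hρ : 0 < ρ := Real.sqrt_pos.mpr hκpos
  have hρ2 : (ρ : ℂ) * ρ = κ := by exact_mod_cast Real.mul_self_sqrt hκpos.le
  have hρ0 : (ρ : ℂ) ≠ 0 := by exact_mod_cast hρ.ne'
  let g : E → ℂ := fun x => H' (F x) (F (e 0)) / H x (e 0) / ρ
  have hga : AnalyticAt ℂ g (e 0) := by
    have h1 : AnalyticAt ℂ (fun x => H x (e 0)) (e 0) :=
      (H.flip (e 0)).toContinuousLinearMap.analyticAt (e 0)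
    exact ((analyticOnNhd_form_left H' hF.analytic _ _ (heO 0)).div h1
      (by rw [hH00]; exact one_ne_zero)).div analyticAt_const hρ0
  have hg0 : g (e 0) ≠ 0 := by
    simp only [g, hH00, hκ, div_one]
    exact div_ne_zero (by exact_mod_cast hκpos.ne') hρ0
  have hne : ∀ᶠ x in 𝓝 (e 0), x ∈ O ∧ g x ≠ 0 := by
    exact (hF.isOpen.eventually_mem (heO 0)).and (hga.continuousAt.eventually_ne hg0)
  let y : E → T := fun x => (g x)⁻¹ • F x
  have hgram : ∀ x w, x ∈ O ∧ g x ≠ 0 → w ∈ O ∧ g w ≠ 0 → H' (y x) (y w) = H x w := by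
    intro x w hx hw
    have h1 := hrank x hx.1 w hw.1
    have hx1 : H x (e 0) ≠ 0 := fun h => hx.2 (by simp [g, h])
    have hw1 : H w (e 0) ≠ 0 := fun h => hw.2 (by simp [g, h])
    have hx2 : H' (F x) (F (e 0)) ≠ 0 := fun h => hx.2 (by simp [g, h])
    have hw2 : H' (F w) (F (e 0)) ≠ 0 := fun h => hw.2 (by simp [g, h])
    have hw3 : H (e 0) w ≠ 0 := fun h => hw1 (hH.eq_zero_symm h)
    have hw4 : H' (F (e 0)) (F w) ≠ 0 := fun h => hw2 (hH'.eq_zero_symm h)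
    simp only [y, map_smul, LinearMap.smul_apply, LinearMap.map_smulₛₗ, g, map_inv₀, map_div₀,
      Complex.conj_ofReal, smul_eq_mul]
    rw [hH w (e 0), hH' (F w) (F (e 0))]
    rw [hκ, ← hρ2] at h1
    field_simp
    linear_combination h1
  obtain ⟨ε, hε, hball⟩ := Metric.eventually_nhds_iff_ball.mp hne
  have hspan : (⊤ : Submodule ℂ E) ≤ Submodule.span ℂ (Metric.ball (e 0) ε) := by
    refine (Submodule.eq_top_of_nonempty_interior' _ ⟨e 0, ?_⟩).ge
    exact interior_mono Submodule.subset_span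
      (by rw [Metric.isOpen_ball.interior_eq]; exact Metric.mem_ball_self hε)
  let b := Module.Basis.ofSpan hspan
  have hb : ∀ i, b i ∈ Metric.ball (e 0) ε := fun i =>
    Module.Basis.ofSpan_subset hspan (Set.mem_range_self i)
  let A : E →ₗ[ℂ] T := b.constr ℂ (fun i => y (b i))
  have hAb : ∀ i, A (b i) = y (b i) := fun i => b.constr_basis ℂ _ i
  have hAleft : ∀ (z : T) (x : E), (∀ j, H' z (A (b j)) = H x (b j)) →
      ∀ w, H' z (A w) = H x w := by
    intro z x h w
    have : (H' z).comp A = H x := b.ext fun j => by simpa using h j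
    exact LinearMap.congr_fun this w
  have hAA : ∀ x w, H' (A x) (A w) = H x w := by
    intro x
    refine hAleft _ _ fun j => ?_
    have : (H'.flip (A (b j))).comp A = H.flip (b j) := b.ext fun i => by
      simp only [LinearMap.comp_apply, LinearMap.flip_apply, hAb]
      exact hgram _ _ (hball _ (hb i)) (hball _ (hb j))
    exact LinearMap.congr_fun this x
  refine ⟨A, g, hAA, hga, hg0, ?_⟩
  filter_upwards [Metric.ball_mem_nhds (e 0) hε] with x hx
  have hx' := hball x hx
  have hyA : ∀ w, H' (y x) (A w) = H x w := hAleft _ _ fun j => by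
    rw [hAb]; exact hgram _ _ hx' (hball _ (hb j))
  have hAy : H' (A x) (y x) = H x x := by rw [← hH', hyA, hH]
  -- The difference is orthogonal to a maximal positive subspace and has square zero.
  have hd : y x - A x = 0 := by
    refine hk.eq_zero hH' (y := fun i => A (e i)) (fun i j hij => ?_) (fun i => ?_) (fun i => ?_) ?_
    · simp [hAA, hev.pos, hij]
    · simp [hAA, hev.pos]
    · simp [hyA, hAA]
    · simp only [map_sub, LinearMap.sub_apply, hyA, hAA, hAy, hgram x x hx' hx']
      simp
  rw [← sub_eq_zero.mp hd]
  simp only [y]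
  rw [smul_inv_smul₀ hx'.2]

/-! ### Polarization -/

/-- Polarization: if `F` sends null vectors near the null vector `v` to null vectors, then it sends
orthogonal vectors near `v` to orthogonal vectors. Two orthogonal vectors `x`, `w` are joined by a
complex curve `Z` with `Z 1 = x` and `Z (-1) = w`, null for imaginary parameters, and the function
`t ↦ H'(F (Z t), F (Z (-conj t)))` is holomorphic and vanishes on the imaginary axis. -/
theorem exists_ball_orthogonal (hH : IsHermitianForm H)
    (hHc : Continuous fun p : E × E => H p.1 p.2) {v p : E} (hv : H v v = 0) (hp : H p p = 0)
    (hpv : H p v ≠ 0) (hF : AnalyticAt ℂ F v)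
    (hnull : ∀ᶠ x in 𝓝 v, H x x = 0 → H' (F x) (F x) = 0) :
    ∃ ε > 0, ∀ x ∈ Metric.ball v ε, ∀ w ∈ Metric.ball v ε, H x w = 0 → H' (F x) (F w) = 0 := by
  obtain ⟨R, hR, hball⟩ := Metric.eventually_nhds_iff_ball.mp
    (hF.eventually_analyticAt.and hnull)
  set c : ℝ := ‖H p v‖ with hc
  have hcpos : 0 < c := norm_pos_iff.mpr hpv
  let m : E × E → E := fun z => (1 / 2 : ℂ) • (z.1 + z.2)
  let d : E × E → E := fun z => (1 / 2 : ℂ) • (z.1 - z.2)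
  have hmc : Continuous m := by fun_prop
  have hdc : Continuous d := by fun_prop
  have hm0 : m (v, v) = v := by simp only [m]; module
  have hd0 : d (v, v) = 0 := by simp only [d]; module
  have hsmall : ∀ᶠ z : E × E in 𝓝 (v, v), ‖m z - v‖ < R / 4 ∧ ‖d z‖ < R / 8 ∧
      c / 2 < ‖H p (m z)‖ ∧ ‖H p (d z)‖ < c / 8 ∧ 10 * ‖H (m z) (m z)‖ / c * ‖p‖ < R / 4 := by
    have c1 : Continuous fun z => ‖m z - v‖ := by fun_prop
    have c2 : Continuous fun z => ‖d z‖ := by fun_prop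
    have c3 : Continuous fun z => ‖H p (m z)‖ :=
      (hHc.comp (f := fun z => (p, m z)) (by fun_prop)).norm
    have c4 : Continuous fun z => ‖H p (d z)‖ :=
      (hHc.comp (f := fun z => (p, d z)) (by fun_prop)).norm
    have c5 : Continuous fun z => 10 * ‖H (m z) (m z)‖ / c * ‖p‖ := by
      have := (hHc.comp (f := fun z => (m z, m z)) (by fun_prop)).norm
      exact ((continuous_const.mul this).div_const c).mul_const _
    refine (c1.continuousAt.eventually_lt_const ?_).and <|
      (c2.continuousAt.eventually_lt_const ?_).and <|
      (c3.continuousAt.eventually_const_lt ?_).and <|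
      (c4.continuousAt.eventually_lt_const ?_).and (c5.continuousAt.eventually_lt_const ?_)
    · beta_reduce; rw [hm0]; simpa using hR
    · beta_reduce; rw [hd0]; simpa using hR
    · beta_reduce; rw [hm0, ← hc]; linarith
    · beta_reduce; rw [hd0]; simpa using hcpos
    · beta_reduce; rw [hm0, hv]; simpa using hR
  rw [nhds_prod_eq, Filter.eventually_prod_iff] at hsmall
  obtain ⟨P₁, hP₁, P₂, hP₂, hsm⟩ := hsmall
  obtain ⟨ε, hε, hballε⟩ := Metric.eventually_nhds_iff_ball.mp (hP₁.and hP₂)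
  refine ⟨ε, hε, fun x hx w hw hxw => ?_⟩
  obtain ⟨s1, s2, s3, s4, s5⟩ := hsm (hballε x hx).1 (hballε w hw).2
  set M := m (x, w) with hM
  set D := d (x, w) with hD
  have hx' : x = M + D := by simp only [hM, hD, m, d]; module
  have hw' : w = M - D := by simp only [hM, hD, m, d]; module
  have hrel1 : H D M = H M D ∧ H D D = H M M := by
    rw [hx', hw'] at hxw
    simp only [map_add, map_sub, LinearMap.add_apply] at hxw
    have h1 := congrArg (starRingEnd ℂ) hxw
    have hh : ∀ x y, (starRingEnd ℂ) (H x y) = H y x := hH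
    simp only [map_add, map_sub, map_zero, hh] at h1
    constructor
    · linear_combination (hxw - h1) / 2
    · linear_combination -(hxw + h1) / 2
  let den : ℂ → ℂ := fun t => H p M - t * H p D
  have hden : ∀ t ∈ Metric.ball (0 : ℂ) 2, c / 4 ≤ ‖den t‖ := by
    intro t ht
    have ht' : ‖t‖ < 2 := by simpa using ht
    have h1 : ‖t * H p D‖ ≤ c / 4 := by
      rw [norm_mul]
      nlinarith [norm_nonneg t, norm_nonneg (H p D)]
    have h2 := norm_sub_norm_le (H p M) (t * H p D)
    simp only [den]
    linarith
  have hden0 : ∀ t ∈ Metric.ball (0 : ℂ) 2, den t ≠ 0 := fun t ht h => by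
    have := hden t ht
    rw [h, norm_zero] at this
    linarith
  let τ : ℂ → ℂ := fun t => -(H M M * (1 - t ^ 2)) / (2 * den t)
  let Z : ℂ → E := fun t => M + t • D + τ t • p
  have hZball : ∀ t ∈ Metric.ball (0 : ℂ) 2, Z t ∈ Metric.ball v R := by
    intro t ht
    have ht' : ‖t‖ < 2 := by simpa using ht
    have hτ : ‖τ t‖ ≤ 10 * ‖H M M‖ / c := by
      have h1 : ‖1 - t ^ 2‖ ≤ 5 := by
        refine (norm_sub_le _ _).trans ?_
        rw [norm_one, norm_pow]
        nlinarith [norm_nonneg t]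
      simp only [τ, norm_div, norm_neg, norm_mul, Complex.norm_ofNat]
      rw [div_le_div_iff₀ (mul_pos two_pos (lt_of_lt_of_le (by positivity) (hden t ht))) hcpos]
      have h2 := hden t ht
      nlinarith [mul_le_mul_of_nonneg_left h1 (norm_nonneg (H M M)), norm_nonneg (H M M),
        mul_le_mul_of_nonneg_left h2 (norm_nonneg (H M M))]
    rw [Metric.mem_ball, dist_eq_norm]
    have e1 : Z t - v = (M - v) + t • D + τ t • p := by simp only [Z]; abel
    rw [e1]
    have h3 : ‖t • D‖ ≤ R / 4 := by
      rw [norm_smul]; nlinarith [norm_nonneg t, norm_nonneg D]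
    have h4 : ‖τ t • p‖ < R / 4 := by
      rw [norm_smul]
      exact (mul_le_mul_of_nonneg_right hτ (norm_nonneg p)).trans_lt s5
    calc _ ≤ ‖M - v‖ + ‖t • D‖ + ‖τ t • p‖ := norm_add₃_le
      _ < R := by linarith
  have hZd : DifferentiableOn ℂ Z (Metric.ball 0 2) := by
    intro t ht
    have h1 : DifferentiableAt ℂ τ t := by
      have h2 : DifferentiableAt ℂ den t := by simp only [den]; fun_prop
      exact DifferentiableAt.div (by fun_prop) (h2.const_mul 2)
        (mul_ne_zero two_ne_zero (hden0 t ht))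
    have h3 : DifferentiableAt ℂ Z t := by
      simp only [Z]
      exact ((differentiableAt_id.smul_const D).const_add M).add (h1.smul_const p)
    exact h3.differentiableWithinAt
  let Γ : ℂ → T := fun t => F (Z t)
  have hΓ : ∀ t ∈ Metric.ball (0 : ℂ) 2, DifferentiableAt ℂ Γ t := fun t ht =>
    DifferentiableAt.comp t (hball _ (hZball t ht)).1.differentiableAt
      (hZd.differentiableAt (Metric.isOpen_ball.mem_nhds ht))
  have hsym : ∀ t ∈ Metric.ball (0 : ℂ) 2, -(starRingEnd ℂ) t ∈ Metric.ball (0 : ℂ) 2 := by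
    intro t ht
    simpa using ht
  let β := Module.finBasis ℂ T
  have hexp : ∀ y z : T, H' y z = ∑ i, (starRingEnd ℂ) (β.repr z i) * H' y (β i) := by
    intro y z
    nth_rewrite 1 [← β.sum_repr z]
    rw [map_sum]
    refine Finset.sum_congr rfl fun i _ => ?_
    rw [LinearMap.map_smulₛₗ, smul_eq_mul]
  have hkd : DifferentiableOn ℂ (fun t => H' (Γ t) (Γ (-(starRingEnd ℂ) t))) (Metric.ball 0 2) := by
    intro t ht
    have e1 : (fun t => H' (Γ t) (Γ (-(starRingEnd ℂ) t))) = fun t =>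
        ∑ i, (starRingEnd ℂ) (β.repr (Γ (-(starRingEnd ℂ) t)) i) * H' (Γ t) (β i) := by
      ext t; exact hexp _ _
    rw [e1]
    refine DifferentiableAt.differentiableWithinAt (DifferentiableAt.fun_sum fun i _ => ?_)
    refine DifferentiableAt.mul ?_ ?_
    · have h1 : DifferentiableAt ℂ (fun t => β.repr (Γ t) i) (-(starRingEnd ℂ) t) :=
        ((β.coord i).toContinuousLinearMap.differentiableAt).comp _ (hΓ _ (hsym t ht))
      have h2 : DifferentiableAt ℂ (fun t => β.repr (Γ (-t)) i) ((starRingEnd ℂ) t) :=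
        DifferentiableAt.comp (g := fun t => β.repr (Γ t) i) _ h1 differentiableAt_id.neg
      have h3 := h2.conj_conj
      simpa [Function.comp_def] using h3
    · exact ((H'.flip (β i)).toContinuousLinearMap.differentiableAt).comp t (hΓ t ht)
  have hzero := eq_zero_of_eq_zero_on_vertical_line Metric.isOpen_ball
    (convex_ball (0 : ℂ) 2).isPreconnected (hkd.analyticOnNhd Metric.isOpen_ball) (t₀ := 0)
    (by simp) (fun t ht hre => by
      have htc : (starRingEnd ℂ) t = -t := by
        have := Complex.add_conj t
        rw [hre] at this
        simp only [Complex.zero_re, mul_zero, Complex.ofReal_zero] at this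
        linear_combination this
      simp only [htc, neg_neg]
      refine (hball _ (hZball t ht)).2 ?_
      have hd := hden0 t ht
      have hMM : (starRingEnd ℂ) (H M M) = H M M := hH _ _
      have hdc : (starRingEnd ℂ) (den t) = H M p + t * H D p := by
        simp only [den, map_sub, map_mul, htc]
        rw [hH, hH]; ring
      have hd' : H M p + t * H D p ≠ 0 := by
        rw [← hdc]
        exact (map_ne_zero _).mpr hd
      have hτc : (starRingEnd ℂ) (τ t) = -(H M M * (1 - t ^ 2)) / (2 * (H M p + t * H D p)) := by
        simp only [τ, map_div₀, map_neg, map_mul, map_sub, map_pow, map_one, hMM, htc, hdc,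
          map_ofNat, neg_sq]
      have e2 : H (Z t) (Z t) = H M M * (1 - t ^ 2) + τ t * den t
          + (starRingEnd ℂ) (τ t) * (H M p + t * H D p) := by
        simp only [Z, map_add, map_smul, LinearMap.add_apply, LinearMap.smul_apply,
          LinearMap.map_smulₛₗ, smul_eq_mul, htc, hp, hrel1.2, den]
        linear_combination t * hrel1.1
      rw [e2, hτc]
      simp only [τ]
      field_simp
      ring) 1 (by simp)
  have hZ1 : Z 1 = x := by simp [Z, τ, hx']
  have hZ2 : Z (-1) = w := by
    simp only [Z, τ, hw']
    norm_num
    abel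
  simpa [Γ, hZ1, hZ2] using hzero

end OrthogonalMaps

/-! ### Isometries of Hermitian forms -/

section Completion

variable {T : Type*} [NormedAddCommGroup T] [NormedSpace ℂ T] [FiniteDimensional ℂ T]
  {H : T →ₗ[ℂ] T →ₗ⋆[ℂ] ℂ}

/-- An orthonormal sequence that contains a maximal number of positive vectors can be completed by
negative vectors to an orthonormal basis. -/
theorem exists_orthonormal_completion (hH : IsHermitianForm H) {κ : ℕ} (hκ : NonnegIndexLE H κ)
    (d : ℕ) : ∀ (k : ℕ) (a : ℕ → T), κ ≤ k → k + d = Module.finrank ℂ T →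
    (∀ i < k, ∀ j < k, H (a i) (a j) = if i = j then (if i < κ then 1 else -1) else 0) →
    ∃ a' : ℕ → T, (∀ i < k, a' i = a i) ∧ ∀ i < k + d, ∀ j < k + d,
      H (a' i) (a' j) = if i = j then (if i < κ then 1 else -1) else 0 := by
  induction d with
  | zero => exact fun k a _ _ ha => ⟨a, fun _ _ => rfl, ha⟩
  | succ d ih =>
    intro k a hk hd ha
    let φ : T →ₗ[ℂ] (Fin k → ℂ) := LinearMap.pi fun i => H.flip (a i)
    obtain ⟨v, hv, hv0⟩ := Submodule.exists_mem_ne_zero_of_ne_bot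
      (φ.ker_ne_bot_of_finrank_lt (by simp; omega))
    have hva : ∀ i < k, H v (a i) = 0 := fun i hi => by
      have := congrFun (LinearMap.mem_ker.mp hv) ⟨i, hi⟩
      simpa [φ] using this
    have hneg : (H v v).re < 0 := by
      by_contra! hnn
      refine hv0 (hκ.eq_zero hH (y := fun i => a i) (fun i j hij => ?_) (fun i => ?_)
        (fun i => hva i (by omega)) hnn)
      · rw [ha i (by omega) j (by omega), if_neg (by simpa [Fin.ext_iff] using hij)]
      · rw [ha i (by omega) i (by omega)]
        simp
    set ρ : ℝ := √(-(H v v).re) with hρ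
    have hρpos : 0 < ρ := Real.sqrt_pos.mpr (by linarith)
    have hρ2 : (ρ : ℂ) * ρ = -H v v := by
      rw [hH.self_eq_re v, ← Complex.ofReal_neg, ← Complex.ofReal_mul]
      exact congrArg _ (Real.mul_self_sqrt (by linarith))
    have hρ0 : (ρ : ℂ) ≠ 0 := by exact_mod_cast hρpos.ne'
    let w : T := (ρ : ℂ)⁻¹ • v
    have hww : H w w = -1 := by
      simp only [w, map_smul, LinearMap.smul_apply, LinearMap.map_smulₛₗ, map_inv₀,
        Complex.conj_ofReal, smul_eq_mul]
      field_simp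
      linear_combination hρ2
    have hwa : ∀ i < k, H w (a i) = 0 := fun i hi => by simp [w, hva i hi]
    have haw : ∀ i < k, H (a i) w = 0 := fun i hi => hH.eq_zero_symm (hwa i hi)
    obtain ⟨a', ha', hfin⟩ := ih (k + 1) (Function.update a k w) (by omega) (by omega) (by
      intro i hi j hj
      rcases Nat.lt_succ_iff_lt_or_eq.mp hi with hi | rfl <;>
        rcases Nat.lt_succ_iff_lt_or_eq.mp hj with hj | rfl
      · rw [Function.update_of_ne hi.ne, Function.update_of_ne hj.ne, ha i hi j hj]
      · rw [Function.update_of_ne hi.ne, Function.update_self, haw i hi, if_neg hi.ne]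
      · rw [Function.update_of_ne hj.ne, Function.update_self, hwa j hj, if_neg hj.ne']
      · rw [Function.update_self, hww, if_pos rfl, if_neg (by omega)])
    refine ⟨a', fun i hi => ?_, fun i hi j hj => hfin i (by omega) j (by omega)⟩
    rw [ha' i (by omega), Function.update_of_ne hi.ne]

end Completion

section Contraction

variable {E : Type*} [NormedAddCommGroup E] [NormedSpace ℂ E] [FiniteDimensional ℂ E]
  {H : E →ₗ[ℂ] E →ₗ⋆[ℂ] ℂ}

/-- The quasi-reflection `x ↦ x + (H x d / H p d) d` with `d = v - p` is an isometry mapping the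
null vector `p` to the null vector `v`. -/
theorem exists_isometry_map_null (hH : IsHermitianForm H) {p v : E} (hp : H p p = 0)
    (hv : H v v = 0) (hpv : H p v ≠ 0) :
    ∃ R : E ≃ₗ[ℂ] E, (∀ x y, H (R x) (R y) = H x y) ∧ R p = v := by
  have hconj : ∀ x y, (starRingEnd ℂ) (H x y) = H y x := hH
  have hvp : H v p ≠ 0 := fun h => hpv (hH.eq_zero_symm h)
  let R : E →ₗ[ℂ] E := LinearMap.id + (((H p v)⁻¹ • H.flip (v - p)).smulRight (v - p))
  have hR : ∀ x, R x = x + ((H p v)⁻¹ * (H x v - H x p)) • (v - p) := fun x => by simp [R]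
  have hinj : Function.Injective R := by
    rw [injective_iff_map_eq_zero]
    intro x hx
    set c := (H p v)⁻¹ * (H x v - H x p) with hc
    have hx' : x = -(c • (v - p)) := by
      rw [hR] at hx
      exact eq_neg_of_add_eq_zero_left hx
    have h1 : H x v - H x p = c * (H p v + H v p) := by
      rw [hx']
      simp only [map_neg, map_smul, map_sub, LinearMap.neg_apply, LinearMap.smul_apply,
        LinearMap.sub_apply, hv, hp, smul_eq_mul]
      ring
    have h2 : c * H p v = H x v - H x p := by
      rw [hc]; field_simp
    have h3 : c * H v p = 0 := by linear_combination -h1 - h2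
    have h4 : c = 0 := (mul_eq_zero.mp h3).resolve_right hvp
    rw [hx', h4, zero_smul, neg_zero]
  refine ⟨LinearEquiv.ofInjectiveEndo R hinj, fun x y => ?_, ?_⟩
  · simp only [LinearEquiv.coe_ofInjectiveEndo, hR, map_add, map_sub, map_smul,
      LinearMap.add_apply, LinearMap.smul_apply, LinearMap.sub_apply, LinearMap.map_smulₛₗ,
      smul_eq_mul, map_mul, map_inv₀, hconj, hp, hv]
    field_simp
    ring
  · simp [hR, hp, hpv]

/-- A linear map, isometric up to scale, that contracts any finite family of vectors off the
hyperplane orthogonal to the null vector `u` towards a given null vector `v`. It is the composition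
of the isometry `p ↦ η p`, `u ↦ η⁻¹ u` for large `η`, rescaled, with an isometry mapping `p`
to `v`. -/
theorem exists_isometry_contracting (hH : IsHermitianForm H) {p u v : E} {κ : ℝ} (hκ : κ ≠ 0)
    (hp : H p p = 0) (hu : H u u = 0) (hpu : H p u = κ) (hv : H v v = 0) (hpv : H p v ≠ 0)
    {ι : Type*} [Finite ι] {x : ι → E} (hx : ∀ i, H (x i) u = 1) {ε : ℝ} (hε : 0 < ε) :
    ∃ (R : E ≃ₗ[ℂ] E) (c : ℝ), 0 < c ∧ (∀ y z, H (R y) (R z) = c * H y z) ∧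
      ∀ i, R (x i) ∈ Metric.ball v ε := by
  have hconj : ∀ x y, (starRingEnd ℂ) (H x y) = H y x := hH
  have hκ0 : (κ : ℂ) ≠ 0 := by exact_mod_cast hκ
  have hup : H u p = κ := by rw [← hconj, hpu, Complex.conj_ofReal]
  let G : ℝ → E →ₗ[ℂ] E := fun δ => (κ * δ : ℂ) • LinearMap.id
    + ((1 - δ : ℂ) • H.flip u).smulRight p + ((δ ^ 2 - δ : ℂ) • H.flip p).smulRight u
  have hG : ∀ δ y, G δ y = (κ * δ : ℂ) • y + ((1 - δ : ℂ) * H y u) • p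
      + ((δ ^ 2 - δ : ℂ) * H y p) • u := fun δ y => by simp [G]
  have hinj : ∀ δ : ℝ, δ ≠ 0 → Function.Injective (G δ) := by
    intro δ hδ
    have hδ' : (δ : ℂ) ≠ 0 := by exact_mod_cast hδ
    rw [injective_iff_map_eq_zero]
    intro y hy
    have h1 := congrArg (fun z => H z u) hy
    have h2 := congrArg (fun z => H z p) hy
    simp only [hG, map_add, map_smul, LinearMap.add_apply, LinearMap.smul_apply, smul_eq_mul, hp,
      hu, hpu, hup, map_zero, LinearMap.zero_apply] at h1 h2
    have h3 : H y u = 0 := by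
      refine mul_left_cancel₀ hκ0 ?_
      linear_combination h1
    have h4 : H y p = 0 := by
      refine mul_left_cancel₀ (mul_ne_zero hκ0 (pow_ne_zero 2 hδ')) ?_
      linear_combination h2
    rw [hG, h3, h4] at hy
    simpa [hκ0, hδ'] using hy
  have hiso : ∀ δ y z, H (G δ y) (G δ z) = ((κ * δ) ^ 2 : ℝ) * H y z := by
    intro δ y z
    simp only [hG, map_add, map_smul, LinearMap.add_apply, LinearMap.smul_apply,
      LinearMap.map_smulₛₗ, smul_eq_mul, map_mul, map_sub, map_pow, map_one, Complex.conj_ofReal,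
      hconj, hp, hu, hpu, hup]
    push_cast
    ring
  obtain ⟨R, hR, hRp⟩ := exists_isometry_map_null hH hp hv hpv
  have hev : ∀ᶠ δ : ℝ in 𝓝 0, ∀ i, R (G δ (x i)) ∈ Metric.ball v ε := by
    refine eventually_all.mpr fun i => ?_
    have hc : Continuous fun δ : ℝ => R (G δ (x i)) := by
      refine (LinearMap.continuous_of_finiteDimensional R.toLinearMap).comp ?_
      simp only [hG]
      fun_prop
    have h0 : R (G 0 (x i)) = v := by simp [hG, hx, hRp]
    exact hc.continuousAt.eventually_mem (by rw [h0]; exact Metric.ball_mem_nhds v hε)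
  obtain ⟨δ, hδ, hδ0⟩ := ((hev.filter_mono nhdsWithin_le_nhds).and
    (self_mem_nhdsWithin : ({0}ᶜ : Set ℝ) ∈ 𝓝[≠] 0)).exists
  have hδ0' : δ ≠ 0 := hδ0
  refine ⟨(LinearEquiv.ofInjectiveEndo (G δ) (hinj δ hδ0)).trans R, (κ * δ) ^ 2, by positivity,
    fun y z => ?_, fun i => ?_⟩
  · simp only [LinearEquiv.trans_apply, LinearEquiv.coe_ofInjectiveEndo, hR, hiso]
  · simpa using hδ i

end Contraction

/-! ### Diagonal forms of given signature -/

section SignatureForm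

/-- The diagonal entries `1, …, 1, -1, …, -1, 0, …` of the Hermitian form defining the generalized
ball: `r + 1` times `1` and `s` times `-1`. -/
noncomputable def signEntry (r s i : ℕ) : ℂ :=
  if i ≤ r then 1 else if i ≤ r + s then -1 else 0

theorem conj_signEntry (r s i : ℕ) : (starRingEnd ℂ) (signEntry r s i) = signEntry r s i := by
  unfold signEntry
  split_ifs <;> simp

/-- The Hermitian form `∑_{i ≤ r} z i conj (w i) - ∑_{r < i ≤ r + s} z i conj (w i)` on `ℂ^(n + 1)`,
linear in the first argument. It is degenerate if `r + s < n`. -/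
noncomputable def signForm (n r s : ℕ) :
    (Fin (n + 1) → ℂ) →ₗ[ℂ] (Fin (n + 1) → ℂ) →ₗ⋆[ℂ] ℂ :=
  LinearMap.mk₂'ₛₗ (RingHom.id ℂ) (starRingEnd ℂ)
    (fun z w => ∑ i : Fin (n + 1), signEntry r s i * z i * (starRingEnd ℂ) (w i))
    (fun z z' w => by
      rw [← Finset.sum_add_distrib]
      exact Finset.sum_congr rfl fun i _ => by rw [Pi.add_apply]; ring)
    (fun c z w => by
      rw [smul_eq_mul, Finset.mul_sum]
      exact Finset.sum_congr rfl fun i _ => by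
        rw [Pi.smul_apply, smul_eq_mul, RingHom.id_apply]; ring)
    (fun z w w' => by
      rw [← Finset.sum_add_distrib]
      exact Finset.sum_congr rfl fun i _ => by rw [Pi.add_apply, map_add]; ring)
    (fun c z w => by
      rw [smul_eq_mul, Finset.mul_sum]
      exact Finset.sum_congr rfl fun i _ => by rw [Pi.smul_apply, smul_eq_mul, map_mul]; ring)

theorem signForm_apply {n r s : ℕ} (z w : Fin (n + 1) → ℂ) :
    signForm n r s z w = ∑ i : Fin (n + 1), signEntry r s i * z i * (starRingEnd ℂ) (w i) := rfl

theorem isHermitianForm_signForm (n r s : ℕ) : IsHermitianForm (signForm n r s) := by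
  intro z w
  rw [signForm_apply, signForm_apply, map_sum]
  refine Finset.sum_congr rfl fun i _ => ?_
  rw [map_mul, map_mul, Complex.conj_conj, conj_signEntry]
  ring

theorem continuous_signForm (n r s : ℕ) :
    Continuous fun q : (Fin (n + 1) → ℂ) × (Fin (n + 1) → ℂ) => signForm n r s q.1 q.2 := by
  simp only [signForm_apply]
  refine continuous_finsetSum _ fun (i : Fin (n + 1)) _ => ?_
  have : Continuous fun q : (Fin (n + 1) → ℂ) × (Fin (n + 1) → ℂ) => (starRingEnd ℂ) (q.2 i) :=
    Complex.continuous_conj.comp ((continuous_apply i).comp continuous_snd)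
  exact (continuous_const.mul ((continuous_apply i).comp continuous_fst)).mul this

theorem signForm_single_right {n r s : ℕ} (z : Fin (n + 1) → ℂ) (j : Fin (n + 1)) :
    signForm n r s z (Pi.single j 1) = signEntry r s j * z j := by
  rw [signForm_apply, Finset.sum_eq_single j]
  · simp
  · intro i _ hij
    simp [Pi.single_eq_of_ne hij]
  · simp

theorem signForm_single_single {n r s : ℕ} (i j : Fin (n + 1)) :
    signForm n r s (Pi.single i 1) (Pi.single j 1) = if i = j then signEntry r s i else 0 := by
  rw [signForm_single_right]
  rcases eq_or_ne i j with rfl | h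
  · simp
  · rw [Pi.single_eq_of_ne h.symm, if_neg h, mul_zero]

theorem re_signForm_self {n r s : ℕ} (z : Fin (n + 1) → ℂ) :
    (signForm n r s z z).re =
      ∑ i ∈ Finset.univ.filter (fun i : Fin (n + 1) => (i : ℕ) ≤ r), ‖z i‖ ^ 2 -
      ∑ i ∈ Finset.univ.filter (fun i : Fin (n + 1) => r < (i : ℕ) ∧ (i : ℕ) ≤ r + s),
        ‖z i‖ ^ 2 := by
  rw [signForm_apply, Complex.re_sum, Finset.sum_filter, Finset.sum_filter,
    ← Finset.sum_sub_distrib]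
  refine Finset.sum_congr rfl fun i _ => ?_
  have h : z i * (starRingEnd ℂ) (z i) = ((‖z i‖ ^ 2 : ℝ) : ℂ) := by
    rw [Complex.mul_conj']; push_cast; rfl
  rw [mul_assoc, h]
  unfold signEntry
  by_cases h1 : (i : ℕ) ≤ r
  · rw [if_pos h1, if_pos h1, if_neg (by omega)]
    simp [-Complex.ofReal_pow]
  · by_cases h2 : (i : ℕ) ≤ r + s
    · rw [if_neg h1, if_pos h2, if_neg h1, if_pos (by omega)]
      simp [-Complex.ofReal_pow]
    · rw [if_neg h1, if_neg h2, if_neg h1, if_neg (by omega)]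
      simp

/-- A subspace on which a form of signature `(r + 1, s)` is nonnegative has dimension at most
`r + 1`: given `r + 2` independent
vectors, some combination of them has vanishing positive coordinates. -/
theorem nonnegIndexLE_signForm (r s : ℕ) : NonnegIndexLE (signForm (r + s) r s) (r + 1) := by
  intro y horth hnn hli
  let φ : (Fin (r + 1 + 1) → ℂ) →ₗ[ℂ] (Fin (r + 1) → ℂ) :=
    LinearMap.funLeft ℂ ℂ (Fin.castLE (by omega) : Fin (r + 1) → Fin (r + s + 1)) ∘ₗ
      Fintype.linearCombination ℂ y
  obtain ⟨c, hc, hc0⟩ := Submodule.exists_mem_ne_zero_of_ne_bot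
    (φ.ker_ne_bot_of_finrank_lt (by simp))
  set v := ∑ i, c i • y i with hv
  have hvpos : ∀ i : Fin (r + s + 1), (i : ℕ) ≤ r → v i = 0 := by
    intro i hi
    have := congrFun (LinearMap.mem_ker.mp hc) ⟨i, by omega⟩
    rw [hv, Finset.sum_apply]
    simpa [φ, LinearMap.funLeft_apply, Fintype.linearCombination_apply] using this
  have hvv : 0 ≤ (signForm (r + s) r s v v).re := by
    have h1 : signForm (r + s) r s v v =
        ∑ i, ((‖c i‖ ^ 2 : ℝ) : ℂ) * signForm (r + s) r s (y i) (y i) := by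
      nth_rewrite 2 [hv]
      rw [map_sum]
      refine Finset.sum_congr rfl fun i _ => ?_
      rw [LinearMap.map_smulₛₗ, hv, form_sum_orthogonal _ horth, smul_eq_mul, ← mul_assoc,
        Complex.conj_mul']
      push_cast
      ring
    rw [h1, Complex.re_sum]
    refine Finset.sum_nonneg fun i _ => ?_
    rw [Complex.re_ofReal_mul]
    exact mul_nonneg (sq_nonneg _) (hnn i)
  rw [re_signForm_self, Finset.sum_eq_zero (fun i hi => by
    rw [hvpos i (Finset.mem_filter.mp hi).2]; simp), zero_sub, Left.nonneg_neg_iff] at hvv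
  have hv0 : v = 0 := by
    have h2 := (Finset.sum_eq_zero_iff_of_nonneg (fun i _ => sq_nonneg ‖v i‖)).mp
      (le_antisymm hvv (Finset.sum_nonneg fun i _ => sq_nonneg _))
    ext i
    by_cases hi : (i : ℕ) ≤ r
    · exact hvpos i hi
    · have := h2 i (Finset.mem_filter.mpr ⟨Finset.mem_univ _, by omega, by omega⟩)
      simpa using this
  exact hc0 (funext fun i => Fintype.linearIndependent_iff.mp hli c hv0 i)

/-- The projection of `ℂ^(m + 1)` to the first `r + s + 1` coordinates, the quotient by the radical
of `signForm m r s`. -/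
noncomputable def headProj {m r s : ℕ} (h : r + s ≤ m) :
    (Fin (m + 1) → ℂ) →ₗ[ℂ] (Fin (r + s + 1) → ℂ) :=
  LinearMap.funLeft ℂ ℂ (Fin.castLE (by omega))

theorem headProj_apply {m r s : ℕ} (h : r + s ≤ m) (y : Fin (m + 1) → ℂ) (i : Fin (r + s + 1)) :
    headProj h y i = y (Fin.castLE (by omega) i) := rfl

theorem signForm_headProj {m r s : ℕ} (h : r + s ≤ m) (y z : Fin (m + 1) → ℂ) :
    signForm (r + s) r s (headProj h y) (headProj h z) = signForm m r s y z := by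
  rw [signForm_apply, signForm_apply]
  refine Fintype.sum_of_injective (Fin.castLE (by omega)) (Fin.castLE_injective _) _ _ ?_ ?_
  · intro i hi
    have : ¬ (i : ℕ) ≤ r + s := fun hle => hi ⟨⟨i, by omega⟩, by ext; simp⟩
    simp [signEntry, this, show ¬ (i : ℕ) ≤ r by omega]
  · intro i
    simp [headProj_apply]

/-- An isometry of `ℂ^(n + 1)` into a nondegenerate form with the same number of positive squares
becomes the standard inclusion of the first `r + s + 1` coordinates after an isometry of the
target. -/
theorem exists_isometry_normalizing {n r s s' : ℕ} (hn : r + s ≤ n)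
    {A : (Fin (n + 1) → ℂ) →ₗ[ℂ] (Fin (r + s' + 1) → ℂ)}
    (hA : ∀ x w, signForm (r + s') r s' (A x) (A w) = signForm n r s x w) :
    s ≤ s' ∧ ∃ B : (Fin (r + s' + 1) → ℂ) ≃ₗ[ℂ] (Fin (r + s' + 1) → ℂ),
      (∀ y z, signForm (r + s') r s' (B y) (B z) = signForm (r + s') r s' y z) ∧
      ∀ x (i : Fin (r + s' + 1)), B (A x) i =
        if h : (i : ℕ) ≤ r + s then x ⟨i, by omega⟩ else 0 := by
  have hH' := isHermitianForm_signForm (r + s') r s'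
  have hk := nonnegIndexLE_signForm r s'
  let a : ℕ → (Fin (r + s' + 1) → ℂ) := fun i =>
    if h : i < n + 1 then A (Pi.single ⟨i, h⟩ 1) else 0
  have ha : ∀ i (h : i < n + 1), a i = A (Pi.single ⟨i, h⟩ 1) := fun i h => dif_pos h
  have hgram : ∀ i < r + s + 1, ∀ j < r + s + 1, signForm (r + s') r s' (a i) (a j) =
      if i = j then (if i < r + 1 then 1 else -1) else 0 := by
    intro i hi j hj
    rw [ha i (by omega), ha j (by omega), hA, signForm_single_single]
    simp only [Fin.mk.injEq, signEntry, Nat.lt_succ_iff]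
    rw [if_pos (by omega : i ≤ r + s)]
  have hle : r + s + 1 ≤ r + s' + 1 := by
    have hli := linearIndependent_of_orthogonal (H := signForm (r + s') r s')
      (y := fun i : Fin (r + s + 1) => a i)
      (fun i j hij => by
        rw [hgram i i.2 j j.2, if_neg (by simpa [Fin.ext_iff] using hij)])
      (fun i => by
        rw [hgram i i.2 i i.2, if_pos rfl]
        split_ifs <;> simp)
    simpa using hli.fintype_card_le_finrank
  refine ⟨by omega, ?_⟩
  obtain ⟨a', ha', hgram'⟩ := exists_orthonormal_completion hH' hk (s' - s) (r + s + 1) a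
    (by omega) (by simp; omega) hgram
  have hcard : r + s + 1 + (s' - s) = r + s' + 1 := by omega
  rw [hcard] at hgram'
  let C : (Fin (r + s' + 1) → ℂ) →ₗ[ℂ] (Fin (r + s' + 1) → ℂ) :=
    Fintype.linearCombination ℂ (fun i : Fin (r + s' + 1) => a' i)
  have hC : ∀ y, C y = ∑ i : Fin (r + s' + 1), y i • a' i := fun y =>
    Fintype.linearCombination_apply ℂ _ y
  have hCiso : ∀ y z, signForm (r + s') r s' (C y) (C z) = signForm (r + s') r s' y z := by
    intro y z
    rw [hC z, map_sum, signForm_apply]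
    refine Finset.sum_congr rfl fun j _ => ?_
    rw [LinearMap.map_smulₛₗ, hC y, form_sum_orthogonal (signForm (r + s') r s')
      (y := fun i : Fin (r + s' + 1) => a' i) (fun i j hij => by
        rw [hgram' i i.2 j j.2, if_neg (by simpa [Fin.ext_iff] using hij)]),
      hgram' j j.2 j j.2, if_pos rfl, smul_eq_mul]
    simp only [signEntry, Nat.lt_succ_iff]
    rw [if_pos (by omega : (j : ℕ) ≤ r + s')]
    ring
  have hinj : Function.Injective C := by
    rw [injective_iff_map_eq_zero]
    intro y hy
    ext j
    have h1 := hCiso y (Pi.single j 1)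
    rw [hy, map_zero, LinearMap.zero_apply, signForm_single_right] at h1
    have h2 : signEntry r s' j ≠ 0 := by
      unfold signEntry
      rw [if_pos (by omega : (j : ℕ) ≤ r + s')]
      split_ifs <;> simp
    exact (mul_eq_zero.mp h1.symm).resolve_left h2
  let C' := LinearEquiv.ofInjectiveEndo C hinj
  have hC' : ∀ y, C' y = C y := fun y => rfl
  refine ⟨C'.symm, fun y z => ?_, fun x i => ?_⟩
  · rw [← hCiso, ← hC', ← hC', C'.apply_symm_apply, C'.apply_symm_apply]
  -- The radical of the source form is killed by `A`.
  have hrad : ∀ i : Fin (n + 1), ¬ (i : ℕ) ≤ r + s → A (Pi.single i 1) = 0 := by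
    intro i hi
    have h0 : ∀ j, signForm (r + s') r s' (A (Pi.single i 1)) (A (Pi.single j 1)) = 0 := by
      intro j
      rw [hA, signForm_single_single]
      simp [signEntry, hi, show ¬ (i : ℕ) ≤ r by omega]
    refine hk.eq_zero hH' (y := fun j : Fin (r + 1) => a j) (fun j l hjl => ?_) (fun j => ?_)
      (fun j => ?_) ?_
    · rw [hgram j (by omega) l (by omega), if_neg (by simpa [Fin.ext_iff] using hjl)]
    · rw [hgram j (by omega) j (by omega), if_pos rfl, if_pos j.2]
      simp
    · rw [ha j (by omega)]
      exact h0 _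
    · rw [h0]; simp
  let x' : Fin (r + s' + 1) → ℂ := fun i => if h : (i : ℕ) ≤ r + s then x ⟨i, by omega⟩ else 0
  have hAx : A x = C x' := by
    rw [hC]
    have h1 : A x = ∑ i, x i • A (Pi.single i 1) := by
      nth_rewrite 1 [pi_eq_sum_univ' x]
      rw [map_sum]
      refine Finset.sum_congr rfl fun i _ => ?_
      rw [map_smul]
    have h2 : ∀ (N : ℕ) (hN : r + s ≤ N) (f : Fin (N + 1) → (Fin (r + s' + 1) → ℂ)),
        (∀ i : Fin (N + 1), ¬ (i : ℕ) ≤ r + s → f i = 0) →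
        ∑ i, f i = ∑ i : Fin (r + s + 1), f (Fin.castLE (by omega) i) := by
      intro N hN f hf
      have hle : r + s + 1 ≤ N + 1 := by omega
      refine (Fintype.sum_of_injective (Fin.castLE hle) (Fin.castLE_injective hle)
        (fun i => f (Fin.castLE hle i)) f ?_ fun i => rfl).symm
      intro i hi
      exact hf i fun hle => hi ⟨⟨i, by omega⟩, by ext; simp⟩
    rw [h1, h2 n hn _ (fun (i : Fin (n + 1)) hi => by rw [hrad i hi, smul_zero]),
      h2 (r + s') (by omega) _ (fun (i : Fin (r + s' + 1)) hi => by simp [x', hi])]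
    refine Finset.sum_congr rfl fun i _ => ?_
    have h3 : (i : ℕ) ≤ r + s := by omega
    rw [Fin.val_castLE, ha' i i.2, ha i (by omega)]
    simp only [x', Fin.val_castLE, dif_pos h3]
    rfl
  rw [hAx, ← hC', C'.symm_apply_apply]

end SignatureForm

/-! ### Normal form near a null vector -/

section NormalForm

/-- Near a null vector there is a null vector that is not orthogonal to `p`, if some null vector `u`
is not orthogonal to `p`: move along `u` in a direction that keeps the square zero. -/
theorem exists_null_of_eventually {E : Type*} [NormedAddCommGroup E] [NormedSpace ℂ E]
    {H : E →ₗ[ℂ] E →ₗ⋆[ℂ] ℂ} (hH : IsHermitianForm H) {p u v : E} (hu : H u u = 0)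
    (hpu : H p u ≠ 0) (hv : H v v = 0) {P : E → Prop} (hP : ∀ᶠ x in 𝓝 v, P x) :
    ∃ w, P w ∧ H w w = 0 ∧ H p w ≠ 0 := by
  by_cases hpv : H p v = 0
  swap
  · exact ⟨v, hP.self_of_nhds, hv, hpv⟩
  have hconj : (starRingEnd ℂ) (H v u) = H u v := hH v u
  obtain ⟨σ, hσ, hσ0⟩ : ∃ σ : ℂ, (starRingEnd ℂ) σ * H v u + σ * H u v = 0 ∧ σ ≠ 0 := by
    by_cases h : H v u = 0
    · exact ⟨1, by rw [h, hH.eq_zero_symm h]; simp, one_ne_zero⟩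
    · refine ⟨Complex.I * H v u, ?_, mul_ne_zero Complex.I_ne_zero h⟩
      rw [map_mul, Complex.conj_I, hconj]
      ring
  have hcont : Continuous fun t : ℝ => v + (t * σ : ℂ) • u := by fun_prop
  have hev : ∀ᶠ t : ℝ in 𝓝 0, P (v + (t * σ : ℂ) • u) :=
    hcont.continuousAt.eventually (by simpa using hP)
  obtain ⟨t, ht, ht0⟩ := ((hev.filter_mono nhdsWithin_le_nhds).and
    (self_mem_nhdsWithin : ({0}ᶜ : Set ℝ) ∈ 𝓝[≠] 0)).exists
  have ht0' : (t : ℂ) ≠ 0 := by exact_mod_cast ht0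
  refine ⟨_, ht, ?_, ?_⟩
  · simp only [map_add, map_smul, LinearMap.add_apply, LinearMap.smul_apply, LinearMap.map_smulₛₗ,
      smul_eq_mul, map_mul, Complex.conj_ofReal, hv, hu]
    linear_combination (t : ℂ) * hσ
  · simp [hpv, hpu, hσ0, ht0']

/-- The standard hyperbolic frame: `r + 1` positive basis vectors and as many negative ones. -/
theorem isHyperbolicFrame_single {n r s : ℕ} (hn : r + s ≤ n) (hs : r < s) :
    IsHyperbolicFrame (signForm n r s)
      (fun l : Fin (r + 1) => Pi.single (⟨l, by omega⟩ : Fin (n + 1)) (1 : ℂ))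
      (fun l : Fin (r + 1) => Pi.single (⟨r + 1 + l, by omega⟩ : Fin (n + 1)) (1 : ℂ)) where
  pos i j := by
    rw [signForm_single_single]
    simp [signEntry, Fin.ext_iff, show (i : ℕ) ≤ r by omega]
  neg i j := by
    rw [signForm_single_single]
    simp [signEntry, Fin.ext_iff, show ¬ r + 1 + (i : ℕ) ≤ r by omega,
      show r + 1 + (i : ℕ) ≤ r + s by omega]
  orth i j := by
    rw [signForm_single_single, if_neg (by simp; omega)]
  orth' i j := by
    rw [signForm_single_single, if_neg (by simp; omega)]

/-- A map germ at a null vector of a form of signature `(r + 1, s)`, `r < s`, that preserves null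
vectors and positive vectors is, up to linear isometries of both sides and a scalar factor, the
standard inclusion near a suitable positive vector. -/
theorem exists_normal_form {n r s r' s' : ℕ} (hn : r + s ≤ n) (hr' : 1 ≤ r') (hr : r' ≤ r)
    (hs : r < s) {v : Fin (n + 1) → ℂ} (hv : signForm n r s v v = 0)
    {F : (Fin (n + 1) → ℂ) → (Fin (r' + s' + 1) → ℂ)} (hF : AnalyticAt ℂ F v)
    (hnull : ∀ᶠ x in 𝓝 v, signForm n r s x x = 0 → signForm (r' + s') r' s' (F x) (F x) = 0)
    (hpos : ∀ᶠ x in 𝓝 v, 0 < (signForm n r s x x).re →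
      0 < (signForm (r' + s') r' s' (F x) (F x)).re)
    {P : (Fin (n + 1) → ℂ) → Prop} (hP : ∀ᶠ x in 𝓝 v, P x) :
    r = r' ∧ s ≤ s' ∧ ∃ (R : (Fin (n + 1) → ℂ) ≃ₗ[ℂ] (Fin (n + 1) → ℂ)) (c : ℝ)
      (B : (Fin (r' + s' + 1) → ℂ) ≃ₗ[ℂ] (Fin (r' + s' + 1) → ℂ)) (g : (Fin (n + 1) → ℂ) → ℂ),
      0 < c ∧ (∀ y z, signForm n r s (R y) (R z) = c * signForm n r s y z) ∧
      P (R (Pi.single 0 1)) ∧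
      (∀ y z, signForm (r' + s') r' s' (B y) (B z) = signForm (r' + s') r' s' y z) ∧
      AnalyticAt ℂ g (Pi.single 0 1) ∧ g (Pi.single 0 1) ≠ 0 ∧
      ∀ᶠ x in 𝓝 (Pi.single 0 1), ∀ i : Fin (r' + s' + 1),
        B (F (R x)) i = g x * if h : (i : ℕ) ≤ r + s then x ⟨i, by omega⟩ else 0 := by
  have hH := isHermitianForm_signForm n r s
  have hH' := isHermitianForm_signForm (r' + s') r' s'
  have hHc := continuous_signForm n r s
  have hev := isHyperbolicFrame_single hn hs
  set e : Fin (r + 1) → (Fin (n + 1) → ℂ) := fun l => Pi.single ⟨l, by omega⟩ 1 with he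
  set d : Fin (r + 1) → (Fin (n + 1) → ℂ) := fun l => Pi.single ⟨r + 1 + l, by omega⟩ 1 with hd
  set H := signForm n r s with hHdef
  set H' := signForm (r' + s') r' s' with hHdef'
  -- The null vectors `p` and `u` span a hyperbolic plane, and `u` has product `1` with the frame.
  set p := ∑ l, (e l + d l) with hpdef
  set u := ∑ l, (e l - d l) with hudef
  have hep : ∀ l, H (e l) p = 1 := fun l => by
    simp [hpdef, map_sum, hev.pos, hev.orth]
  have hdp : ∀ l, H (d l) p = -1 := fun l => by
    simp [hpdef, map_sum, hev.neg, hev.orth']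
  have heu : ∀ l, H (e l) u = 1 := fun l => by
    simp [hudef, map_sum, hev.pos, hev.orth]
  have hdu : ∀ l, H (d l) u = 1 := fun l => by
    simp [hudef, map_sum, hev.neg, hev.orth']
  have hp : H p p = 0 := by
    nth_rewrite 1 [hpdef]
    simp [map_sum, LinearMap.sum_apply, hep, hdp]
  have hu : H u u = 0 := by
    nth_rewrite 1 [hudef]
    simp [map_sum, LinearMap.sum_apply, heu, hdu]
  have hpu : H p u = ((2 * (r + 1) : ℝ) : ℂ) := by
    rw [hpdef]
    simp [map_sum, LinearMap.sum_apply, heu, hdu]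
    ring
  have hκ : (2 * (r + 1) : ℝ) ≠ 0 := by positivity
  obtain ⟨w, ⟨hwF, hwnull, hwpos, hwP⟩, hw, hpw⟩ := exists_null_of_eventually hH (p := p) hu
    (by rw [hpu]; exact_mod_cast hκ) hv
    (hF.eventually_analyticAt.and (hnull.eventually_nhds.and (hpos.eventually_nhds.and
      hP.eventually_nhds)))
  obtain ⟨ε₁, hε₁, hball₁⟩ := exists_ball_orthogonal hH hHc hw hp hpw hwF hwnull
  obtain ⟨ε₂, hε₂, hball₂⟩ := Metric.eventually_nhds_iff_ball.mp
    (hwF.eventually_analyticAt.and (hwpos.and hwP))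
  set ε := min ε₁ ε₂ with hε
  have hsub₁ : Metric.ball w ε ⊆ Metric.ball w ε₁ := Metric.ball_subset_ball (min_le_left _ _)
  have hsub₂ : Metric.ball w ε ⊆ Metric.ball w ε₂ := Metric.ball_subset_ball (min_le_right _ _)
  obtain ⟨R, c, hc, hR, hRx⟩ := exists_isometry_contracting hH hκ hp hu hpu hw hpw
    (x := Sum.elim e fun l => (1 / 2 : ℂ) • (e l + d l)) (by
      rintro (l | l)
      · exact heu l
      · simp only [Sum.elim_inr, map_smul, LinearMap.smul_apply, map_add, LinearMap.add_apply,
          heu, hdu, smul_eq_mul]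
        norm_num) (lt_min hε₁ hε₂ : 0 < ε)
  have heO : ∀ l, R (e l) ∈ Metric.ball w ε := fun l => hRx (Sum.inl l)
  have hRc : Continuous R := LinearMap.continuous_of_finiteDimensional R.toLinearMap
  have hc0 : (c : ℂ) ≠ 0 := by exact_mod_cast hc.ne'
  have hRpos : ∀ y, 0 < (H y y).re → 0 < (H (R y) (R y)).re := fun y hy => by
    rw [hR, Complex.re_ofReal_mul]
    exact mul_pos hc hy
  have hloc : IsLocalOrthogonal H H' (R ⁻¹' Metric.ball w ε) (fun x => F (R x)) :=
    { isOpen := Metric.isOpen_ball.preimage hRc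
      convex := (convex_ball w ε).linear_preimage (R.toLinearMap.restrictScalars ℝ)
      analytic := fun x hx => AnalyticAt.comp (g := F) (f := R) (hball₂ _ (hsub₂ hx)).1
        ((LinearMap.toContinuousLinearMap R.toLinearMap).analyticAt x)
      orth := fun x hx y hy hxy => hball₁ _ (hsub₁ hx) _ (hsub₁ hy) (by rw [hR, hxy, mul_zero])
      pos := fun x hx hxx => (hball₂ _ (hsub₂ hx)).2.1 (hRpos x hxx) }
  have hk := nonnegIndexLE_signForm r' s'
  -- Otherwise the images of the `e l` would be too many orthogonal positive vectors.
  have hrr : r = r' := by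
    by_contra hne
    have hlt : r' < r := lt_of_le_of_ne hr (Ne.symm hne)
    let y : Fin (r' + 1 + 1) → (Fin (r' + s' + 1) → ℂ) := fun i =>
      F (R (e (Fin.castLE (by omega) i)))
    have horth : ∀ i j, i ≠ j → H' (y i) (y j) = 0 := fun i j hij =>
      hloc.orth _ (heO _) _ (heO _) (by
        rw [hev.pos, if_neg fun h => hij (Fin.castLE_injective _ h)])
    have hypos : ∀ i, 0 < (H' (y i) (y i)).re := fun i =>
      hloc.pos _ (heO _) (by simp [hev.pos])
    refine hk y horth (fun i => (hypos i).le) (linearIndependent_of_orthogonal horth fun i h => ?_)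
    have := hypos i
    simp [h] at this
  subst hrr
  obtain ⟨q, rfl⟩ : ∃ q, r = q + 1 := ⟨r - 1, by omega⟩
  obtain ⟨A, g, hA, hg, hg0, hFA⟩ := hloc.exists_isometry hH hH' hHc (q := q) hk hev
    (fun i => hRx (Sum.inr i)) heO
  obtain ⟨hss, B, hB, hBA⟩ := exists_isometry_normalizing hn hA
  refine ⟨rfl, hss, R, c, B, g, hc, hR, (hball₂ _ (hsub₂ (heO 0))).2.2, hB, hg, hg0, ?_⟩
  have he0 : e 0 = Pi.single 0 1 := rfl
  rw [← he0]
  filter_upwards [hFA] with x hx i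
  rw [hx, map_smul, Pi.smul_apply, hBA, smul_eq_mul]

end NormalForm

/-! ### Generalized balls in projective space -/

section Projective

theorem mk_mem_genBall {n r s : ℕ} {v : Fin (n + 1) → ℂ} (hv : v ≠ 0) :
    Projectivization.mk ℂ v hv ∈ genBall n r s ↔ 0 < (signForm n r s v v).re := by
  rw [mk_mem_genBall_iff, re_signForm_self, sub_pos]

theorem exists_re_signForm_rep {n : ℕ} (r s : ℕ) {v : Fin (n + 1) → ℂ} (hv : v ≠ 0) :
    ∃ c : ℝ, 0 < c ∧ (signForm n r s (Projectivization.mk ℂ v hv).rep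
      (Projectivization.mk ℂ v hv).rep).re = c * (signForm n r s v v).re := by
  obtain ⟨a, ha⟩ := Projectivization.exists_smul_eq_mk_rep ℂ v hv
  refine ⟨‖(a : ℂ)‖ ^ 2, by have := norm_pos_iff.mpr a.ne_zero; positivity, ?_⟩
  have h : signForm n r s ((a : ℂ) • v) ((a : ℂ) • v) =
      ((‖(a : ℂ)‖ ^ 2 : ℝ) : ℂ) * signForm n r s v v := by
    simp only [map_smul, LinearMap.smul_apply, LinearMap.map_smulₛₗ, smul_eq_mul]
    rw [Complex.ofReal_pow, ← Complex.mul_conj']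
    ring
  rw [← ha, Units.smul_def, h, Complex.re_ofReal_mul]

theorem isOpen_of_isOpen_lift {n : ℕ} {U : Set (CProj n)}
    (h : IsOpen {v : Fin (n + 1) → ℂ | ∃ hv : v ≠ 0, Projectivization.mk ℂ v hv ∈ U}) :
    IsOpen U := by
  refine isOpen_coinduced.mpr ?_
  convert h.preimage (continuous_subtype_val (p := fun v : Fin (n + 1) → ℂ => v ≠ 0)) using 1
  ext v
  simp [Projectivization.mk'_eq_mk, v.2]

theorem eventually_mk_mem {n : ℕ} {U : Set (CProj n)} (hU : IsOpen U) {v : Fin (n + 1) → ℂ}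
    (hv : v ≠ 0) (hvU : Projectivization.mk ℂ v hv ∈ U) :
    ∀ᶠ w in 𝓝 v, ∃ hw : w ≠ 0, Projectivization.mk ℂ w hw ∈ U := by
  have h1 := (isOpen_ne (x := (0 : Fin (n + 1) → ℂ))).isOpenMap_subtype_val _
    (isOpen_coinduced.mp hU)
  filter_upwards [h1.mem_nhds ⟨⟨v, hv⟩, hvU, rfl⟩]
  rintro w ⟨⟨w, hw⟩, hwU, rfl⟩
  exact ⟨hw, hwU⟩

theorem continuous_re_signForm (n r s : ℕ) :
    Continuous fun v : Fin (n + 1) → ℂ => (signForm n r s v v).re :=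
  Complex.continuous_re.comp ((continuous_signForm n r s).comp (continuous_id.prodMk continuous_id))

theorem re_signForm_eq_zero_of_mem_frontier {n r s : ℕ} {v : Fin (n + 1) → ℂ} (hv : v ≠ 0)
    (h : Projectivization.mk ℂ v hv ∈ frontier (genBall n r s)) :
    (signForm n r s v v).re = 0 := by
  have hopen : IsOpen (genBall n r s) := isOpen_of_isOpen_lift (by
    convert isOpen_lt continuous_const (continuous_re_signForm n r s) using 1
    ext w
    refine ⟨fun ⟨hw, h⟩ => (mk_mem_genBall hw).mp h, fun h => ?_⟩
    have hw : w ≠ 0 := by rintro rfl; simp at h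
    exact ⟨hw, (mk_mem_genBall hw).mpr h⟩)
  rw [hopen.frontier_eq] at h
  refine le_antisymm (not_lt.mp fun hlt => h.2 ((mk_mem_genBall hv).mpr hlt)) (not_lt.mp
    fun hlt => ?_)
  let N : Set (CProj n) := {p | (signForm n r s p.rep p.rep).re < 0}
  have hN : ∀ {w : Fin (n + 1) → ℂ} (hw : w ≠ 0),
      Projectivization.mk ℂ w hw ∈ N ↔ (signForm n r s w w).re < 0 := by
    intro w hw
    obtain ⟨c, hc, h⟩ := exists_re_signForm_rep r s hw
    change (signForm n r s _ _).re < 0 ↔ _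
    rw [h]
    exact ⟨fun h => neg_of_mul_neg_right h hc.le, fun h => mul_neg_of_pos_of_neg hc h⟩
  have hNopen : IsOpen N := isOpen_of_isOpen_lift (by
    convert isOpen_lt (continuous_re_signForm n r s) continuous_const using 1
    ext w
    refine ⟨fun ⟨hw, h⟩ => (hN hw).mp h, fun h => ?_⟩
    have hw : w ≠ 0 := by rintro rfl; simp at h
    exact ⟨hw, (hN hw).mpr h⟩)
  obtain ⟨p, hpN, hpB⟩ := mem_closure_iff.mp h.1 N hNopen ((hN hv).mpr hlt)
  induction p using Projectivization.ind with
  | h w hw => exact lt_asymm ((hN hw).mp hpN) ((mk_mem_genBall hw).mp hpB)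

/-- A null vector is a limit of positive vectors: add a small multiple of the first basis vector,
with a suitable sign. -/
theorem mem_frontier_of_re_signForm_eq_zero {n r s : ℕ} {v : Fin (n + 1) → ℂ} (hv : v ≠ 0)
    (h : (signForm n r s v v).re = 0) :
    Projectivization.mk ℂ v hv ∈ frontier (genBall n r s) := by
  refine ⟨mem_closure_iff.mpr fun O hO hvO => ?_, fun hint => ?_⟩
  · have hev := eventually_mk_mem hO hv hvO
    let σ : ℝ := if 0 ≤ (v 0).re then 1 else -1
    have hσ : σ * σ = 1 := by simp only [σ]; split_ifs <;> norm_num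
    have hσv : 0 ≤ σ * (v 0).re := by
      simp only [σ]; split_ifs with h
      · simpa using h
      · push Not at h; linarith
    have hcont : Continuous fun t : ℝ => v + (σ * t : ℂ) • (Pi.single 0 1 : Fin (n + 1) → ℂ) := by
      fun_prop
    have hev' := (hcont.tendsto' 0 v (by simp)).eventually hev
    obtain ⟨t, ⟨hw, hwO⟩, ht⟩ := ((hev'.filter_mono nhdsWithin_le_nhds).and
      (self_mem_nhdsWithin : Ioi (0 : ℝ) ∈ 𝓝[>] 0)).exists
    refine ⟨_, hwO, (mk_mem_genBall hw).mpr ?_⟩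
    have h1 : signForm n r s v (Pi.single 0 1) = v 0 := by
      rw [signForm_single_right]; simp [signEntry]
    have h2 : signForm n r s (Pi.single 0 1) v = (starRingEnd ℂ) (v 0) := by
      rw [← h1]; exact (isHermitianForm_signForm n r s _ _).symm
    have h3 : signForm n r s (Pi.single 0 1) (Pi.single 0 1) = 1 := by
      rw [signForm_single_right]; simp [signEntry]
    have ht' : 0 < t := ht
    have : (signForm n r s (v + (σ * t : ℂ) • (Pi.single 0 1 : Fin (n + 1) → ℂ))
        (v + (σ * t : ℂ) • (Pi.single 0 1 : Fin (n + 1) → ℂ))).re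
        = 2 * t * (σ * (v 0).re) + t ^ 2 := by
      simp only [map_add, map_smul, LinearMap.add_apply, LinearMap.smul_apply,
        LinearMap.map_smulₛₗ, smul_eq_mul, Complex.conj_ofReal, h1, h2, h3,
        ← Complex.ofReal_mul, Complex.add_re, Complex.re_ofReal_mul, Complex.conj_re,
        Complex.one_re, h]
      linear_combination t ^ 2 * hσ
    rw [this]
    positivity
  · exact lt_irrefl _ (h ▸ (mk_mem_genBall hv).mp (interior_subset hint))

/-- A linear automorphism that preserves the Hermitian form up to a positive factor induces an
automorphism of the generalized ball. -/
theorem isHolAut_map {n r s : ℕ} (T : (Fin (n + 1) → ℂ) ≃ₗ[ℂ] (Fin (n + 1) → ℂ)) {c : ℝ}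
    (hc : 0 < c) (hT : ∀ y z, signForm n r s (T y) (T z) = c * signForm n r s y z) :
    IsHolAut (genBall n r s) (Projectivization.map T.toLinearMap T.injective) := by
  have key : ∀ (S : (Fin (n + 1) → ℂ) ≃ₗ[ℂ] (Fin (n + 1) → ℂ)) {b : ℝ}, 0 < b →
      (∀ y z, signForm n r s (S y) (S z) = b * signForm n r s y z) →
      MapsTo (Projectivization.map S.toLinearMap S.injective) (genBall n r s) (genBall n r s) ∧
      HolOn (Projectivization.map S.toLinearMap S.injective) (genBall n r s) := by
    intro S b hb hS
    refine ⟨fun p hp => ?_, fun v hv _ => ⟨S, ?_, ?_⟩⟩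
    · induction p using Projectivization.ind with
      | h v hv =>
        rw [Projectivization.map_mk, mk_mem_genBall]
        rw [mk_mem_genBall] at hp
        simp only [LinearEquiv.coe_coe]
        rw [hS, Complex.re_ofReal_mul]
        exact mul_pos hb hp
    · exact (LinearMap.toContinuousLinearMap S.toLinearMap).analyticAt v
    · filter_upwards [isOpen_ne.mem_nhds hv] with w hw
      exact ⟨hw, S.map_ne_zero_iff.mpr hw, by rw [Projectivization.map_mk]; rfl⟩
  obtain ⟨h1, h2⟩ := key T hc hT
  obtain ⟨h3, h4⟩ := key T.symm (inv_pos.mpr hc) (fun y z => by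
    have := hT (T.symm y) (T.symm z)
    rw [T.apply_symm_apply, T.apply_symm_apply] at this
    have hc0 : (c : ℂ) ≠ 0 := by exact_mod_cast hc.ne'
    rw [this]
    push_cast
    field_simp)
  refine ⟨h1, h2, _, h3, h4, fun p _ => ?_, fun p _ => ?_⟩ <;>
  · induction p using Projectivization.ind with
    | h v hv => simp [Projectivization.map_mk]

end Projective

/-! ### The affine chart -/

section AffineChart

theorem affPt_injective {n : ℕ} : Function.Injective (affPt : (Fin n → ℂ) → CProj n) := by
  intro z z' h
  obtain ⟨a, ha⟩ := (Projectivization.mk_eq_mk_iff' ℂ _ _ _ _).mp h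
  have h0 := congrFun ha 0
  simp only [Pi.smul_apply, Fin.cons_zero, smul_eq_mul, mul_one] at h0
  rw [h0, one_smul] at ha
  exact ((Fin.cons_inj.mp ha).2).symm

theorem isOpen_image_affPt {n : ℕ} {W : Set (Fin n → ℂ)} (hW : IsOpen W) :
    IsOpen (affPt '' W : Set (CProj n)) := by
  refine isOpen_of_isOpen_lift ?_
  have hcont : ContinuousOn (fun (w : Fin (n + 1) → ℂ) (i : Fin n) => w i.succ / w 0)
      {w | w 0 ≠ 0} :=
    continuousOn_pi.mpr fun i => (continuous_apply i.succ).continuousOn.div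
      (continuous_apply 0).continuousOn fun _ hw => hw
  convert hcont.isOpen_inter_preimage (isOpen_ne.preimage (continuous_apply 0)) hW using 1
  ext w
  constructor
  · rintro ⟨hw, z, hz, hzw⟩
    obtain ⟨a, ha⟩ := (Projectivization.mk_eq_mk_iff' ℂ _ _ _ _).mp hzw
    have h0 : a * w 0 = 1 := by simpa using congrFun ha 0
    have hw0 : w 0 ≠ 0 := right_ne_zero_of_mul_eq_one h0
    refine ⟨hw0, ?_⟩
    suffices h : (fun i : Fin n => w i.succ / w 0) = z from
      mem_preimage.mpr (h.symm ▸ hz)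
    ext i
    have hi : a * w i.succ = z i := by simpa using congrFun ha i.succ
    rw [← hi, div_eq_iff hw0]
    linear_combination (- w i.succ) * h0
  · rintro ⟨hw0, hz⟩
    have hw0' : w 0 ≠ 0 := hw0
    refine ⟨fun h => hw0' (by simp [h]), _, hz, ?_⟩
    refine (Projectivization.mk_eq_mk_iff' ℂ _ _ _ _).mpr ⟨(w 0)⁻¹, ?_⟩
    ext i
    refine Fin.cases ?_ (fun i => ?_) i
    · simp [hw0']
    · simp [div_eq_inv_mul]

theorem differentiable_cons_one (n : ℕ) :
    Differentiable ℂ fun z : Fin n → ℂ => (Fin.cons 1 z : Fin (n + 1) → ℂ) := by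
  refine differentiable_pi.mpr fun i => ?_
  refine Fin.cases ?_ (fun i => ?_) i
  · simp
  · simpa using differentiable_apply i

/-- An automorphism of the first `r + s + 1` coordinates extends by the identity to the remaining
ones. -/
theorem exists_equiv_headProj {m r s : ℕ} (h : r + s ≤ m)
    (B : (Fin (r + s + 1) → ℂ) ≃ₗ[ℂ] (Fin (r + s + 1) → ℂ)) :
    ∃ T : (Fin (m + 1) → ℂ) ≃ₗ[ℂ] (Fin (m + 1) → ℂ),
      (∀ y, headProj h (T y) = B (headProj h y)) ∧
      ∀ y (i : Fin (m + 1)), ¬ (i : ℕ) ≤ r + s → T y i = y i := by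
  let T : (Fin (m + 1) → ℂ) →ₗ[ℂ] (Fin (m + 1) → ℂ) := LinearMap.pi fun i =>
    if hi : (i : ℕ) ≤ r + s then
      LinearMap.proj (⟨i, by omega⟩ : Fin (r + s + 1)) ∘ₗ B.toLinearMap ∘ₗ headProj h
    else LinearMap.proj i
  have h1 : ∀ y, headProj h (T y) = B (headProj h y) := by
    intro y
    ext i
    rw [headProj_apply]
    have hi : (i : ℕ) ≤ r + s := by omega
    simp [T, hi]
  have h2 : ∀ y (i : Fin (m + 1)), ¬ (i : ℕ) ≤ r + s → T y i = y i := by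
    intro y i hi
    simp [T, hi]
  have hinj : Function.Injective T := by
    rw [injective_iff_map_eq_zero]
    intro y hy
    have h3 : headProj h y = 0 := by
      rw [← B.map_eq_zero_iff, ← h1, hy, map_zero]
    ext i
    by_cases hi : (i : ℕ) ≤ r + s
    · exact congrFun h3 ⟨i, by omega⟩
    · rw [← h2 y i hi, hy]
  exact ⟨LinearEquiv.ofInjectiveEndo T hinj, h1, h2⟩

end AffineChart

/-! ### Maps of generalized balls -/

theorem theorem1p2 (n m r s r' s' : ℕ) (hn : r + s ≤ n) (hm : r' + s' ≤ m)
    (hr' : 1 ≤ r') (hr : r' ≤ r) (hs : r < s)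
    (U : Set (CProj n)) (hU : IsOpen U) (hUc : IsConnected U)
    (hUb : (U ∩ frontier (genBall n r s)).Nonempty)
    (f : CProj n → CProj m) (hf : HolOn f U)
    (hfi : MapsTo f (U ∩ genBall n r s) (genBall m r' s'))
    (hfb : MapsTo f (U ∩ frontier (genBall n r s)) (frontier (genBall m r' s'))) :
    r = r' ∧ s ≤ s' ∧
      ∃ (U' : Set (CProj n)) (Ξ : CProj n → CProj n) (Φ : CProj m → CProj m)
        (ψ : Fin (m - r' - s') → CProj n → ℂ),
        IsOpen U' ∧ affPt 0 ∈ U' ∧ U' ⊆ genBall n r s ∧ U' ⊆ range affPt ∧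
        IsHolAut (genBall n r s) Ξ ∧ IsHolAut (genBall m r' s') Φ ∧
        MapsTo Ξ U' U ∧
        (∀ j, DifferentiableOn ℂ (fun z => ψ j (affPt z)) (affPt ⁻¹' U')) ∧
        ∀ z : Fin n → ℂ, affPt z ∈ U' →
          Φ (f (Ξ (affPt z))) =
            Projectivization.mk ℂ
              (normalVec (r + s) m r' s' z (fun j => ψ j (affPt z)))
              (normalVec_ne_zero _ _ _ _ _ _) := by
  obtain ⟨p, hpU, hpf⟩ := hUb
  induction p using Projectivization.ind with
  | h v hv =>
  obtain ⟨F, hF, hfF⟩ := hf v hv hpU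
  have hv0 : signForm n r s v v = 0 := by
    rw [(isHermitianForm_signForm n r s).self_eq_re, re_signForm_eq_zero_of_mem_frontier hv hpf,
      Complex.ofReal_zero]
  have hlift : ∀ᶠ w in 𝓝 v, ∃ (hw : w ≠ 0) (hFw : F w ≠ 0), Projectivization.mk ℂ w hw ∈ U ∧
      f (Projectivization.mk ℂ w hw) = Projectivization.mk ℂ (F w) hFw := by
    filter_upwards [hfF, eventually_mk_mem hU hv hpU]
    rintro w ⟨hw, hFw, h1⟩ ⟨_, h2⟩
    exact ⟨hw, hFw, h2, h1⟩
  have hnull : ∀ᶠ x in 𝓝 v, signForm n r s x x = 0 →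
      signForm (r' + s') r' s' (headProj hm (F x)) (headProj hm (F x)) = 0 := by
    filter_upwards [hlift]
    rintro w ⟨hw, hFw, hwU, hfw⟩ hww
    have h1 := hfb ⟨hwU, mem_frontier_of_re_signForm_eq_zero hw (by rw [hww, Complex.zero_re])⟩
    rw [hfw] at h1
    rw [signForm_headProj, (isHermitianForm_signForm m r' s').self_eq_re,
      re_signForm_eq_zero_of_mem_frontier hFw h1, Complex.ofReal_zero]
  have hpos : ∀ᶠ x in 𝓝 v, 0 < (signForm n r s x x).re →
      0 < (signForm (r' + s') r' s' (headProj hm (F x)) (headProj hm (F x))).re := by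
    filter_upwards [hlift]
    rintro w ⟨hw, hFw, hwU, hfw⟩ hww
    have h1 := hfi ⟨hwU, (mk_mem_genBall hw).mpr hww⟩
    rw [hfw, mk_mem_genBall] at h1
    rwa [signForm_headProj]
  have hF' : AnalyticAt ℂ (fun x => headProj hm (F x)) v :=
    ((LinearMap.toContinuousLinearMap (headProj hm)).analyticAt _).comp hF
  obtain ⟨rfl, hss, R, c, B, g, hc, hR, ⟨hRF, hRlift⟩, hB, hg, hg0, hform⟩ :=
    exists_normal_form hn hr' hr hs hv0 hF' hnull hpos
      (hF.eventually_analyticAt.eventually_nhds.and hlift.eventually_nhds)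
  refine ⟨rfl, hss, ?_⟩
  have hRc : Continuous R := LinearMap.continuous_of_finiteDimensional R.toLinearMap
  have hcons0 : (Fin.cons 1 0 : Fin (n + 1) → ℂ) = Pi.single 0 1 := by
    ext i
    refine Fin.cases ?_ (fun i => ?_) i <;> simp
  have hcons := (differentiable_cons_one n).continuous.tendsto' 0 _ hcons0
  have hpos0 : ∀ᶠ x in 𝓝 (Pi.single 0 1), 0 < (signForm n r s x x).re :=
    (continuous_re_signForm n r s).continuousAt.eventually_mem (by
      rw [signForm_single_single]
      exact Ioi_mem_nhds (by simp [signEntry]))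
  -- `U'` is the set of the points `[1, z]` with `z` in this ball.
  obtain ⟨δ, hδ, hball⟩ := Metric.eventually_nhds_iff_ball.mp (hcons.eventually
    ((hRc.continuousAt.eventually hRF).and ((hRc.continuousAt.eventually hRlift).and
      (hg.eventually_analyticAt.and ((hg.continuousAt.eventually_ne hg0).and
        (hpos0.and hform))))))
  obtain ⟨T, hT, hT'⟩ := exists_equiv_headProj hm B
  have hTiso : ∀ y z, signForm m r s' (T y) (T z) = (1 : ℝ) * signForm m r s' y z := by
    intro y z
    rw [← signForm_headProj hm, hT, hT, hB, signForm_headProj, Complex.ofReal_one, one_mul]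
  have hmem : ∀ {z}, affPt z ∈ affPt '' Metric.ball (0 : Fin n → ℂ) δ → z ∈ Metric.ball 0 δ :=
    fun h => (affPt_injective.mem_set_image).mp h
  have hinv : ∀ z : Fin n → ℂ, Function.invFun affPt (affPt z) = z :=
    Function.leftInverse_invFun affPt_injective
  refine ⟨affPt '' Metric.ball 0 δ, Projectivization.map R.toLinearMap R.injective,
    Projectivization.map T.toLinearMap T.injective,
    fun j p => F (R (Fin.cons 1 (Function.invFun affPt p))) ⟨r + s' + 1 + j, by omega⟩ /
      g (Fin.cons 1 (Function.invFun affPt p)),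
    isOpen_image_affPt Metric.isOpen_ball, ⟨0, Metric.mem_ball_self hδ, rfl⟩, ?_,
    image_subset_range _ _, isHolAut_map R hc hR, isHolAut_map T one_pos hTiso, ?_, ?_, ?_⟩
  · rintro _ ⟨z, hz, rfl⟩
    exact (mk_mem_genBall _).mpr (hball z hz).2.2.2.2.1
  · rintro _ ⟨z, hz, rfl⟩
    obtain ⟨hw, hFw, hwU, -⟩ := (hball z hz).2.1
    rw [affPt, Projectivization.map_mk]
    exact hwU
  · intro j z hz
    obtain ⟨h1, -, h2, h3, -⟩ := hball z (hmem hz)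
    simp only [hinv]
    have hd := (differentiable_cons_one n) z
    have hFR : DifferentiableAt ℂ (fun z : Fin n → ℂ => F (R (Fin.cons 1 z))) z :=
      h1.differentiableAt.comp z
        ((LinearMap.toContinuousLinearMap R.toLinearMap).differentiableAt.comp z hd)
    have hgc : DifferentiableAt ℂ (fun z : Fin n → ℂ => g (Fin.cons 1 z)) z :=
      h2.differentiableAt.comp z hd
    have hFRj := differentiableAt_pi.mp hFR ⟨r + s' + 1 + j, by omega⟩
    simp only [div_eq_mul_inv]
    exact (hFRj.fun_mul (DifferentiableAt.inv hgc h3)).differentiableWithinAt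
  · intro z hz
    obtain ⟨-, ⟨hw, hFw, -, hfw⟩, -, hgz, -, hformz⟩ := hball z (hmem hz)
    have h1 : Projectivization.map R.toLinearMap R.injective (affPt z) =
        Projectivization.mk ℂ (R (Fin.cons 1 z)) hw := by
      rw [affPt, Projectivization.map_mk]
      rfl
    rw [h1, hfw, Projectivization.map_mk]
    -- The homogeneous coordinates of both sides differ by the factor `g`.
    refine (Projectivization.mk_eq_mk_iff' ℂ _ _ _ _).mpr ⟨g (Fin.cons 1 z), ?_⟩
    ext i
    have hhead : ∀ hi : (i : ℕ) ≤ r + s', T (F (R (Fin.cons 1 z))) i =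
        B (headProj hm (F (R (Fin.cons 1 z)))) ⟨i, by omega⟩ := fun hi => by
      rw [← hT, headProj_apply]
      rfl
    rw [Pi.smul_apply, smul_eq_mul, LinearEquiv.coe_coe]
    unfold normalVec
    by_cases hi : (i : ℕ) ≤ r + s
    · rw [dif_pos ⟨hi, by omega⟩, hhead (by omega), hformz, dif_pos hi]
    · rw [dif_neg fun h => hi h.1]
      by_cases hi' : (i : ℕ) ≤ r + s'
      · rw [dif_pos hi', hhead hi', hformz, dif_neg hi]
      · rw [dif_neg hi']
        beta_reduce
        rw [hinv, mul_div_cancel₀ _ hgz, hT' _ _ hi']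
        congr 1
        ext
        simp
        omega
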